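/- Setting (single-lane partition, SLP). A road is modelled by the real line. Fix the number of lanes $n_L\ge 1$, the vehicle density per lane $\lambda_L>0$, the activity probability $p_a\in(0,1]$, the number of orthogonal resources $n_{\rm AR}\ge 1$, the segment length $d_{\mathcal A}>0$, the maximum communication distance $d_{\max}>0$, the path-loss slope $\tau>0$ and exponent $\alpha>0$, and the transmit power $\rho>0$. Vehicles form a homogeneous Poisson point process $\Phi$ on $\mathbb R$ of density $\lambda=\lambda_L n_L$; every vehicle is independently active with probability $p_a$, which gives $\Phi^{(a)}$, and has an independent fading $H$ that is exponential of mean $1$. The $c$-th co-channel segment, $c\in\mathbb Z$, is $\mathcal A_c=[c\,n_{\rm AR}d_{\mathcal A}-\tfrac{d_{\mathcal A}}2,\ c\,n_{\rm AR}d_{\mathcal A}+\tfrac{d_{\mathcal A}}2)$; the probe segment is $\mathcal A_0$. The interference at $x\in\mathbb R$ is $$I(x)=\sum_{y\in\Phi^{(a)}\setminus\{{\rm VT}_0\}}H_y\,(\tau|y-x|)^{-\alpha}\rho\;\mathbf 1\Big(y\in\bigcup_{c\in\mathbb Z}\mathcal A_c\Big)\mathbf 1(|y-x|<d_{\max}),$$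 where ${\rm VT}_0$ is the probe transmitter. Its Laplace transform at $s$ is $\mathcal L_{I(x)}(s)=\mathbb E[e^{-sI(x)}]$, where either (i) ${\rm VT}_0$ is not a point of $\Phi^{(a)}$ (all active vehicles count), or (ii) ${\rm VT}_0$ is a typical active vehicle of the probe segment, located in a given Borel set $B\subseteq\mathcal A_0$ of positive length (Palm expectation), i.e. $$\mathcal L_{I(x)}(s)=\frac{\mathbb E\big[\sum_{v\in\Phi^{(a)}\cap B}e^{-sI(x)}\big|_{{\rm VT}_0=v}\big]}{\mathbb E\big[\#(\Phi^{(a)}\cap B)\big]} .$$ For $c\in\mathbb Z$ and $x\in\mathbb R$ put $$\mu_U^{(1)}=\min\!\big(c\,n_{\rm AR}d_{\mathcal A}+\tfrac{d_{\mathcal A}}2-x,\ d_{\max}\big),\qquad \mu_U^{(2)}=-\max\!\big(c\,n_{\rm AR}d_{\mathcal A}-\tfrac{d_{\mathcal A}}2-x,\ -d_{\max}\big),$$ $$\mu_L^{(1)}=\max(-\mu_U^{(2)},0),\qquad \mu_L^{(2)}=-\min(\mu_U^{(1)},0),$$ $$\kappa(c,s,x)=\sum_{j\in\{1,2\}}\mathbf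 1\big(\mu_L^{(j)}<\mu_U^{(j)}\big)\Big(\mu_U^{(j)}\,{}_2F_1\big(1,\tfrac1\alpha;1+\tfrac1\alpha;\tfrac{(\tau\mu_U^{(j)})^\alpha}{-s\rho}\big)-\mu_L^{(j)}\,{}_2F_1\big(1,\tfrac1\alpha;1+\tfrac1\alpha;\tfrac{(\tau\mu_L^{(j)})^\alpha}{-s\rho}\big)\Big),$$ where ${}_2F_1$ is the Gauss hypergeometric function, analytically continued to $\mathbb C\setminus[1,\infty)$. Lemma. Let $x\in\mathbb R$ and $s>0$, and put $D=d_{\max}/(n_{\rm AR}d_{\mathcal A})$. Under either convention (i), (ii), $$\mathcal L_{I(x)}(s)=\exp\Big(-\lambda\,p_a\sum_{c\in\mathbb Z}\kappa(c,s,x)\Big),$$ where $\kappa(c,s,x)=0$ unless $|c\,n_{\rm AR}d_{\mathcal A}-x|<d_{\max}+\tfrac{d_{\mathcal A}}2$, so that the sum is finite. The sum may be restricted to $|c|\le\lceil D\rceil$ if $|x|+d_{\max}\le(\lceil D\rceil+1)n_{\rm AR}d_{\mathcal A}-\tfrac{d_{\mathcal A}}2$ (in particular if $|x|\le(n_{\rm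 AR}-\tfrac12)d_{\mathcal A}$), and to $-\lfloor D\rfloor\le c\le\lceil D\rceil$ if $d_{\max}+x\le(\lceil D\rceil+1)n_{\rm AR}d_{\mathcal A}-\tfrac{d_{\mathcal A}}2$ and $d_{\max}-x\le(\lfloor D\rfloor+1)n_{\rm AR}d_{\mathcal A}-\tfrac{d_{\mathcal A}}2$ (in particular if $\tfrac{d_{\mathcal A}}2\le x\le(n_{\rm AR}-\tfrac12)d_{\mathcal A}$). -/

import Mathlib

open MeasureTheory ProbabilityTheory

/-! ### The Gauss hypergeometric function on the cut plane -/

/-- The complex plane cut along the real half-line `[1, ∞)`. -/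
def hypergeometricDomain : Set ℂ := {z | 1 - z ∈ Complex.slitPlane}

/-- `f` is the principal branch of `₂F₁(a, b; c; ·)`: it is holomorphic on the plane cut along
`[1, ∞)`, and on the unit disc it is the sum of the Gauss series. -/
def IsGaussHypergeometric (a b c : ℂ) (f : ℂ → ℂ) : Prop :=
  DifferentiableOn ℂ f hypergeometricDomain ∧
    ∀ z ∈ Metric.ball (0 : ℂ) 1, f z = ordinaryHypergeometric a b c z

/-- The Gauss hypergeometric function `₂F₁(a, b; c; z)`: the analytic continuation of the
Gauss series to the plane cut along `[1, ∞)`. (Mathlib's `ordinaryHypergeometric` is the sum of the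
series, hence only meaningful for `‖z‖ < 1`.) -/
noncomputable def gaussHypergeometric (a b c : ℂ) : ℂ → ℂ :=
  Classical.epsilon (IsGaussHypergeometric a b c)

/-- The analytic continuation is unique, so it does not depend on a choice. -/
theorem gaussHypergeometric_eqOn {a b c : ℂ} {f : ℂ → ℂ} (hf : IsGaussHypergeometric a b c f) :
    Set.EqOn (gaussHypergeometric a b c) f hypergeometricDomain := by
  have hg : IsGaussHypergeometric a b c (gaussHypergeometric a b c) := Classical.epsilon_spec ⟨f, hf⟩
  have hopen : IsOpen hypergeometricDomain :=
    Complex.isOpen_slitPlane.preimage (continuous_const.sub continuous_id)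
  have himg : hypergeometricDomain = (fun w : ℂ => 1 - w) '' Complex.slitPlane := by
    ext z
    constructor
    · intro hz
      exact ⟨1 - z, hz, by simp⟩
    · rintro ⟨w, hw, rfl⟩
      simpa [hypergeometricDomain] using hw
  have hconn : IsPreconnected hypergeometricDomain := by
    rw [himg]
    refine IsPreconnected.image ?_ _ (by fun_prop)
    exact (Complex.starConvex_one_slitPlane.isPathConnected
      (Complex.one_mem_slitPlane)).isConnected.isPreconnected
  refine (hg.1.analyticOnNhd hopen).eqOn_of_preconnected_of_eventuallyEq
    (hf.1.analyticOnNhd hopen) hconn (z₀ := 0) (by simp [hypergeometricDomain]) ?_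
  filter_upwards [Metric.ball_mem_nhds (0 : ℂ) one_pos] with z hz
  rw [hg.2 z hz, hf.2 z hz]

/-! ### The road and its parameters -/

/-- The parameters of a vehicular network with single-lane partition. -/
structure SLPParams where
  /-- number of lanes -/
  nL : ℕ
  /-- density of the vehicles per lane -/
  lamL : ℝ
  /-- probability that a vehicle has data to transmit -/
  pa : ℝ
  /-- number of orthogonal resources -/
  nAR : ℕ
  /-- length of a segment -/
  dA : ℝ
  /-- maximum communication distance -/
  dmax : ℝ
  /-- slope of the path loss -/
  tau : ℝ
  /-- exponent of the path loss -/
  alpha : ℝ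
  /-- transmit power per Hz -/
  rho : ℝ
  nL_pos : 0 < nL
  lamL_pos : 0 < lamL
  pa_pos : 0 < pa
  pa_le_one : pa ≤ 1
  nAR_pos : 0 < nAR
  dA_pos : 0 < dA
  dmax_pos : 0 < dmax
  tau_pos : 0 < tau
  alpha_pos : 0 < alpha
  rho_pos : 0 < rho

namespace SLPParams

variable (P : SLPParams)

/-- Density of the vehicles of the whole road. -/
noncomputable def lam : ℝ := P.lamL * P.nL

/-- The co-channel distance: the length of a cluster of `nAR` segments. -/
noncomputable def dC : ℝ := P.nAR * P.dA

/-- The `c`-th co-channel segment; the probe segment is the one with `c = 0`. -/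
def segment (c : ℤ) : Set ℝ :=
  {y | c * P.dC - P.dA / 2 ≤ y ∧ y < c * P.dC + P.dA / 2}

/-- The union of all the segments that use the same resource as the probe segment. -/
def cochannel : Set ℝ := ⋃ c : ℤ, P.segment c

/-- `μ_U⁽¹⁾` -/
noncomputable def muU1 (c : ℤ) (x : ℝ) : ℝ := min (c * P.dC + P.dA / 2 - x) P.dmax

/-- `μ_U⁽²⁾` -/
noncomputable def muU2 (c : ℤ) (x : ℝ) : ℝ := -max (c * P.dC - P.dA / 2 - x) (-P.dmax)

/-- `μ_L⁽¹⁾` -/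
noncomputable def muL1 (c : ℤ) (x : ℝ) : ℝ := max (-P.muU2 c x) 0

/-- `μ_L⁽²⁾` -/
noncomputable def muL2 (c : ℤ) (x : ℝ) : ℝ := -min (P.muU1 c x) 0

/-- `m · ₂F₁(1, 1/α; 1 + 1/α; -(τ m)^α / (s ρ))`, for `m ≥ 0`. -/
noncomputable def hyperTerm (s m : ℝ) : ℝ :=
  m * (gaussHypergeometric 1 ((1 / P.alpha : ℝ) : ℂ) ((1 + 1 / P.alpha : ℝ) : ℂ)
    (((P.tau * m) ^ P.alpha / (-(s * P.rho)) : ℝ) : ℂ)).re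

open Classical in
/-- The contribution `κ(c, s, x)` of the `c`-th co-channel segment. -/
noncomputable def kappa (c : ℤ) (s x : ℝ) : ℝ :=
  (if P.muL1 c x < P.muU1 c x then
      P.hyperTerm s (P.muU1 c x) - P.hyperTerm s (P.muL1 c x) else 0) +
    (if P.muL2 c x < P.muU2 c x then
      P.hyperTerm s (P.muU2 c x) - P.hyperTerm s (P.muL2 c x) else 0)

end SLPParams

/-! ### Vehicles, activity, fading and interference -/

section Network

variable {Ω : Type*} [MeasurableSpace Ω]

/-- The number of points of the enumerated point process `X` in the set `B`. -/
noncomputable def pointCount (X : ℕ → Ω → ℝ) (B : Set ℝ) (ω : Ω) : ℕ∞ :=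
  Set.encard {i | X i ω ∈ B}

/-- The random points `X 0, X 1, …` form a homogeneous Poisson point process of density `lam` on
the real line: the number of points in a Borel set of finite length is Poisson distributed with
mean `lam` times its length, and the numbers of points in disjoint Borel sets are independent. -/
structure IsPoissonPointProcess (μ : Measure Ω) (X : ℕ → Ω → ℝ) (lam : ℝ) : Prop where
  measurable : ∀ i, Measurable (X i)
  count_law : ∀ B : Set ℝ, MeasurableSet B → volume B ≠ ⊤ → ∀ n : ℕ,
    μ {ω | pointCount X B ω = n} = poissonMeasure (lam * (volume B).toReal).toNNReal {n}
  count_indep : ∀ (k : ℕ) (B : Fin k → Set ℝ), (∀ j, MeasurableSet (B j)) →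
    Pairwise (fun i j => Disjoint (B i) (B j)) → iIndepFun (fun j => pointCount X (B j)) μ

/-- The random elements of the single-lane-partition model: the vehicles have positions `X i`,
forming a Poisson point process of density `λ`; vehicle `i` is active (`A i = true`) with
probability `p_a`; its fading `H i` towards the receiver is exponential of mean one; activities
and fadings are independent of each other, across the vehicles and of the positions. -/
structure IsSLPNetwork (μ : Measure Ω) (P : SLPParams) (X : ℕ → Ω → ℝ) (A : ℕ → Ω → Bool)
    (H : ℕ → Ω → ℝ) : Prop where
  poisson : IsPoissonPointProcess μ X P.lam
  measurable_active : ∀ i, Measurable (A i)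
  active_law : ∀ i, μ {ω | A i ω = true} = ENNReal.ofReal P.pa
  measurable_fading : ∀ i, Measurable (H i)
  fading_law : ∀ i, HasLaw (H i) (expMeasure 1) μ
  indep_active_fading : ∀ i, IndepFun (A i) (H i) μ
  indep_marks : iIndepFun (fun i ω => (A i ω, H i ω)) μ
  indep_positions : IndepFun (fun ω i => X i ω) (fun ω i => (A i ω, H i ω)) μ

/-- The vehicles of `J` that interfere at a receiver located at `x`: those which are active, lie in
a co-channel segment, and are within the maximum communication distance of `x`. -/
def interferers (P : SLPParams) (X : ℕ → Ω → ℝ) (A : ℕ → Ω → Bool) (J : Set ℕ) (x : ℝ) (ω : Ω) :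
    Set ℕ :=
  {i | i ∈ J ∧ A i ω = true ∧ X i ω ∈ P.cochannel ∧ X i ω ∈ Metric.ball x P.dmax}

/-- The interference at `x` caused by the vehicles of `J`. (The sum has almost surely finitely many
nonzero terms.) -/
noncomputable def interference (P : SLPParams) (X : ℕ → Ω → ℝ) (A : ℕ → Ω → Bool) (H : ℕ → Ω → ℝ)
    (J : Set ℕ) (x : ℝ) (ω : Ω) : ℝ :=
  ∑' i, (interferers P X A J x ω).indicator
    (fun i => H i ω * (P.tau * |X i ω - x|) ^ (-P.alpha) * P.rho) i

/-- The active vehicles that are located in `B`. -/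
def activeIn (X : ℕ → Ω → ℝ) (A : ℕ → Ω → Bool) (B : Set ℝ) (ω : Ω) : Set ℕ :=
  {k | A k ω = true ∧ X k ω ∈ B}

/-- The Laplace transform at `s` of the interference at `x` caused by all the active vehicles, i.e.
when the probe transmitter is not one of the points of the process. -/
noncomputable def fullLaplace (μ : Measure Ω) (P : SLPParams) (X : ℕ → Ω → ℝ) (A : ℕ → Ω → Bool)
    (H : ℕ → Ω → ℝ) (s x : ℝ) : ℝ :=
  ∫ ω, Real.exp (-(s * interference P X A H Set.univ x ω)) ∂μ

/-- The Laplace transform at `s` of the interference at `x` when the probe transmitter is a typical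
active vehicle located in `B`, i.e. one chosen at random among the active vehicles in `B` (Palm
expectation): the mean, over the active vehicles `k` in `B`, of `exp (-s I(x))`, where `I(x)` is the
interference caused by all the active vehicles other than `k`. -/
noncomputable def typicalLaplace (μ : Measure Ω) (P : SLPParams) (X : ℕ → Ω → ℝ)
    (A : ℕ → Ω → Bool) (H : ℕ → Ω → ℝ) (B : Set ℝ) (s x : ℝ) : ENNReal :=
  (∫⁻ ω, ∑' k, (activeIn X A B ω).indicator
      (fun k => ENNReal.ofReal (Real.exp (-(s * interference P X A H {k}ᶜ x ω)))) k ∂μ) /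
    (∫⁻ ω, ∑' k, (activeIn X A B ω).indicator (fun _ => (1 : ENNReal)) k ∂μ)

/-- `L` is the Laplace transform at `s` of the interference at `x`: for the Poisson process of
active vehicles itself, and also for the active vehicles other than a typical transmitter in the
probe segment, whichever part `B` of the probe segment its position is conditioned to lie in. -/
def IsInterferenceLaplace (μ : Measure Ω) (P : SLPParams) (X : ℕ → Ω → ℝ) (A : ℕ → Ω → Bool)
    (H : ℕ → Ω → ℝ) (s x L : ℝ) : Prop :=
  fullLaplace μ P X A H s x = L ∧
    ∀ B : Set ℝ, MeasurableSet B → B ⊆ P.segment 0 → volume B ≠ 0 →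
      typicalLaplace μ P X A H B s x = ENNReal.ofReal L

end Network

/-! Almost surely only finitely many vehicles lie in `region x`, the bounded set where an active
vehicle interferes. There `exp (-s I(x))` is a finite product of one factor per vehicle
(`ofReal_exp_neg_interference`). Marks are independent of positions and of each other, so they can
be averaged factor by factor (`lintegral_finprod_marked`). An exponential fading turns the factor at
`y` into `1 - p_a * outage s |y - x|`. The Laplace functional of the Poisson process
(`IsPoissonPointProcess.lintegral_finprod`) then gives the exponent `-λ p_a ∫ outage s |y - x|` over
the region.

The region splits into segments. On each, the integral over signed displacements from `x` is cut at
`0`, and Euler's integral evaluates `∫ outage` from `0` to `m` as `m` times a hypergeometric value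
(`hyperTerm_eq_integral`). This yields `κ`.

For a typical transmitter, a Mecke formula (`tsum_lintegral_finprod`) shows that deleting the chosen
point leaves the law of the others Poisson. The numerator of the Palm quotient is `p_a λ |B|` times
the full Laplace transform, and the denominator is the same expression at `s = 0`. The Mecke formula
itself is the first-order term in `t` of the Laplace functional at `g + t 1_B`. -/

/-! ### Euler's integral and the hypergeometric function -/

lemma one_sub_mul_mem_slitPlane {z : ℂ} (hz : z ∈ hypergeometricDomain) {u : ℝ} (hu0 : 0 ≤ u)
    (hu1 : u ≤ 1) : 1 - z * u ∈ Complex.slitPlane := by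
  have hz' : 1 - z ∈ Complex.slitPlane := hz
  -- The point lies on the segment from `1` to `1 - z`, and the slit plane is star-shaped about `1`;
  -- what follows checks this in coordinates.
  rcases hu0.eq_or_lt with rfl | hu
  · simp
  rw [Complex.mem_slitPlane_iff] at hz' ⊢
  simp only [Complex.sub_re, Complex.one_re, Complex.sub_im, Complex.one_im, Complex.re_mul_ofReal,
    Complex.im_mul_ofReal] at hz' ⊢
  rcases hz' with h | h
  · left
    nlinarith
  · right
    intro h'
    apply h
    have : z.im * u = 0 := by linarith
    rcases mul_eq_zero.1 this with h1 | h1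
    · simp [h1]
    · exact absurd h1 hu.ne'

lemma isOpen_hypergeometricDomain : IsOpen hypergeometricDomain :=
  Complex.isOpen_slitPlane.preimage (continuous_const.sub continuous_id)

/-- Euler's integral for `₂F₁(1, 1/α; 1 + 1/α; z)`, after the substitution `t ↦ t ^ α`. -/
noncomputable def eulerIntegral (α : ℝ) (z : ℂ) : ℂ :=
  ∫ t in (0 : ℝ)..1, (1 - z * ((t ^ α : ℝ) : ℂ))⁻¹

lemma rpow_mem_unitInterval {α : ℝ} (hα : 0 < α) {t : ℝ} (ht : t ∈ Set.Icc (0 : ℝ) 1) :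
    t ^ α ∈ Set.Icc (0 : ℝ) 1 :=
  ⟨Real.rpow_nonneg ht.1 _, Real.rpow_le_one ht.1 ht.2 hα.le⟩

lemma differentiableOn_eulerIntegral {α : ℝ} (hα : 0 < α) :
    DifferentiableOn ℂ (eulerIntegral α) hypergeometricDomain := by
  intro z₀ hz₀
  obtain ⟨ε, hε, hball⟩ := Metric.nhds_basis_closedBall.mem_iff.1
    (isOpen_hypergeometricDomain.mem_nhds hz₀)
  have hcont : Continuous fun t : ℝ => ((t ^ α : ℝ) : ℂ) :=
    Complex.continuous_ofReal.comp (Real.continuous_rpow_const hα.le)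
  have hne : ∀ z ∈ Metric.closedBall z₀ ε, ∀ t ∈ Set.Icc (0 : ℝ) 1,
      1 - z * ((t ^ α : ℝ) : ℂ) ≠ 0 := fun z hz t ht =>
    Complex.slitPlane_ne_zero (one_sub_mul_mem_slitPlane (hball hz)
      (rpow_mem_unitInterval hα ht).1 (rpow_mem_unitInterval hα ht).2)
  -- Compactness bounds the denominator below by some `δ > 0`, uniformly in `z` near `z₀` and in
  -- `t`. The `z`-derivative of the integrand is then dominated by the constant `δ⁻²`.
  obtain ⟨p, hp, hmin⟩ := ((isCompact_closedBall z₀ ε).prod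
    (isCompact_Icc (a := (0 : ℝ)) (b := 1))).exists_isMinOn
    ⟨(z₀, 0), by simp [hε.le]⟩
    (f := fun p : ℂ × ℝ => ‖1 - p.1 * ((p.2 ^ α : ℝ) : ℂ)‖)
    (Continuous.continuousOn (by
      exact (continuous_const.sub (continuous_fst.mul (hcont.comp continuous_snd))).norm))
  set δ := ‖1 - p.1 * ((p.2 ^ α : ℝ) : ℂ)‖ with hδ
  have hδ0 : 0 < δ := norm_pos_iff.2 (hne p.1 hp.1 p.2 hp.2)
  have hle : ∀ z ∈ Metric.closedBall z₀ ε, ∀ t ∈ Set.Icc (0 : ℝ) 1,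
      δ ≤ ‖1 - z * ((t ^ α : ℝ) : ℂ)‖ := fun z hz t ht => hmin (Set.mk_mem_prod hz ht)
  have hIoc : Set.uIoc (0 : ℝ) 1 ⊆ Set.Icc 0 1 := by
    rw [Set.uIoc_of_le zero_le_one]
    exact Set.Ioc_subset_Icc_self
  have hinv : ∀ z ∈ Metric.closedBall z₀ ε,
      ContinuousOn (fun t : ℝ => (1 - z * ((t ^ α : ℝ) : ℂ))⁻¹) (Set.uIcc 0 1) := by
    intro z hz
    rw [Set.uIcc_of_le zero_le_one]
    exact (continuous_const.sub (continuous_const.mul hcont)).continuousOn.inv₀ (hne z hz)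
  have hz₀' : z₀ ∈ Metric.closedBall z₀ ε := Metric.mem_closedBall_self hε.le
  refine (intervalIntegral.hasDerivAt_integral_of_dominated_loc_of_deriv_le
    (F := fun z (t : ℝ) => (1 - z * ((t ^ α : ℝ) : ℂ))⁻¹)
    (F' := fun z (t : ℝ) => ((t ^ α : ℝ) : ℂ) * ((1 - z * ((t ^ α : ℝ) : ℂ))⁻¹) ^ 2)
    (bound := fun _ => (δ⁻¹) ^ 2) (s := Metric.closedBall z₀ ε)
    (Metric.closedBall_mem_nhds z₀ hε) ?_ ?_ ?_ ?_ ?_ ?_).2.differentiableAt.differentiableWithinAt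
  · filter_upwards [Metric.closedBall_mem_nhds z₀ hε] with z hz
    exact ((hinv z hz).intervalIntegrable).aestronglyMeasurable_restrict_uIoc
  · exact (hinv z₀ hz₀').intervalIntegrable
  · exact ((hcont.continuousOn.mul ((hinv z₀ hz₀').pow 2)).intervalIntegrable).aestronglyMeasurable_restrict_uIoc
  · refine Filter.Eventually.of_forall fun t ht z hz => ?_
    have h1 := rpow_mem_unitInterval hα (hIoc ht)
    rw [norm_mul, norm_pow, norm_inv, Complex.norm_real, Real.norm_of_nonneg h1.1]
    calc t ^ α * ‖1 - z * ((t ^ α : ℝ) : ℂ)‖⁻¹ ^ 2 ≤ 1 * (δ⁻¹) ^ 2 := by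
          have := hle z hz t (hIoc ht)
          gcongr
          exact h1.2
      _ = (δ⁻¹) ^ 2 := one_mul _
  · exact intervalIntegrable_const
  · refine Filter.Eventually.of_forall fun t ht z hz => ?_
    have hd : HasDerivAt (fun z : ℂ => 1 - z * ((t ^ α : ℝ) : ℂ)) (-((t ^ α : ℝ) : ℂ)) z := by
      simpa using ((hasDerivAt_id z).mul_const ((t ^ α : ℝ) : ℂ)).const_sub 1
    convert! hd.inv (hne z hz t (hIoc ht)) using 1
    field_simp

/-- The product of the ratios `(b + k) / (b + k + 1)` telescopes. -/
lemma ascPochhammer_div_ascPochhammer_add_one {b : ℂ} (hb : ∀ n : ℕ, b + n ≠ 0) (n : ℕ) :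
    (ascPochhammer ℂ n).eval b * ((ascPochhammer ℂ n).eval (1 + b))⁻¹ = b / (b + n) := by
  have hb0 : b ≠ 0 := by simpa using hb 0
  induction n with
  | zero => simp [hb0]
  | succ n ih =>
    rw [ascPochhammer_succ_eval, ascPochhammer_succ_eval, mul_inv]
    have h1 := hb n
    have h2 := hb (n + 1)
    have h3 : 1 + b + n ≠ 0 := by
      convert h2 using 1
      push_cast
      ring
    calc _ = ((ascPochhammer ℂ n).eval b * ((ascPochhammer ℂ n).eval (1 + b))⁻¹) *
          ((b + n) * (1 + b + n)⁻¹) := by ring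
      _ = _ := by
        rw [ih]
        push_cast at h2 ⊢
        have h3' : b + (n + 1) ≠ 0 := by convert h2 using 1
        field_simp
        ring

lemma ordinaryHypergeometric_one_eq_tsum {α : ℝ} (hα : 0 < α) (z : ℂ) :
    ordinaryHypergeometric (1 : ℂ) ((1 / α : ℝ) : ℂ) ((1 + 1 / α : ℝ) : ℂ) z =
      ∑' n : ℕ, ((1 / (α * n + 1) : ℝ) : ℂ) * z ^ n := by
  rw [ordinaryHypergeometric_eq_tsum]
  refine tsum_congr fun n => ?_
  have hb : ∀ n : ℕ, ((1 / α : ℝ) : ℂ) + n ≠ 0 := by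
    intro n
    have : (0 : ℝ) < 1 / α + n := by positivity
    exact_mod_cast this.ne'
  have h1 : (ascPochhammer ℂ n).eval 1 = (n.factorial : ℂ) := ascPochhammer_eval_one ℂ n
  have hn : (n.factorial : ℂ) ≠ 0 := by exact_mod_cast n.factorial_ne_zero
  have hc : ((1 + 1 / α : ℝ) : ℂ) = 1 + ((1 / α : ℝ) : ℂ) := by push_cast; ring
  rw [smul_eq_mul, h1, inv_mul_cancel₀ hn, one_mul, hc,
    ascPochhammer_div_ascPochhammer_add_one hb]
  congr 1
  have : (α * n + 1 : ℝ) ≠ 0 := by positivity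
  rw [← Complex.ofReal_natCast, ← Complex.ofReal_add, ← Complex.ofReal_div]
  congr 1
  field_simp
  ring

/-- Expand the integrand as a geometric series dominated by `‖z‖ ^ n`, and integrate `t ^ (α n)`
termwise. -/
lemma eulerIntegral_eq_tsum {α : ℝ} (hα : 0 < α) {z : ℂ} (hz : ‖z‖ < 1) :
    eulerIntegral α z = ∑' n : ℕ, ((1 / (α * n + 1) : ℝ) : ℂ) * z ^ n := by
  have hcont : Continuous fun t : ℝ => ((t ^ α : ℝ) : ℂ) :=
    Complex.continuous_ofReal.comp (Real.continuous_rpow_const hα.le)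
  have hnorm : ∀ t ∈ Set.uIoc (0 : ℝ) 1, ‖z * ((t ^ α : ℝ) : ℂ)‖ ≤ ‖z‖ := by
    intro t ht
    rw [Set.uIoc_of_le zero_le_one] at ht
    have h1 := rpow_mem_unitInterval hα (Set.Ioc_subset_Icc_self ht)
    rw [norm_mul, Complex.norm_real, Real.norm_of_nonneg h1.1]
    exact mul_le_of_le_one_right (norm_nonneg _) h1.2
  have h := intervalIntegral.hasSum_integral_of_dominated_convergence (μ := volume) (a := 0) (b := 1)
    (F := fun n (t : ℝ) => (z * ((t ^ α : ℝ) : ℂ)) ^ n)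
    (f := fun t : ℝ => (1 - z * ((t ^ α : ℝ) : ℂ))⁻¹) (fun n _ => ‖z‖ ^ n)
    (fun n => ((continuous_const.mul hcont).pow n).aestronglyMeasurable)
    (fun n => Filter.Eventually.of_forall fun t ht => by
      rw [norm_pow]
      exact pow_le_pow_left₀ (norm_nonneg _) (hnorm t ht) n)
    (Filter.Eventually.of_forall fun t _ => summable_geometric_of_lt_one (norm_nonneg _) hz)
    intervalIntegrable_const
    (Filter.Eventually.of_forall fun t ht =>
      hasSum_geometric_of_norm_lt_one ((hnorm t ht).trans_lt hz))
  rw [eulerIntegral, ← h.tsum_eq]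
  refine tsum_congr fun n => ?_
  have hi : ∫ t in (0 : ℝ)..1, (z * ((t ^ α : ℝ) : ℂ)) ^ n =
      ∫ t in (0 : ℝ)..1, z ^ n * ((t ^ (α * n) : ℝ) : ℂ) := by
    refine intervalIntegral.integral_congr fun t ht => ?_
    rw [Set.uIcc_of_le zero_le_one] at ht
    rw [mul_pow, Real.rpow_mul_natCast ht.1, Complex.ofReal_pow]
  have hpos : (-1 : ℝ) < α * n := by
    have : 0 ≤ α * n := by positivity
    linarith
  rw [hi, intervalIntegral.integral_const_mul, intervalIntegral.integral_ofReal,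
    integral_rpow (Or.inl hpos), Real.one_rpow, Real.zero_rpow (by linarith), sub_zero, mul_comm]

theorem isGaussHypergeometric_eulerIntegral {α : ℝ} (hα : 0 < α) :
    IsGaussHypergeometric 1 ((1 / α : ℝ) : ℂ) ((1 + 1 / α : ℝ) : ℂ) (eulerIntegral α) := by
  refine ⟨differentiableOn_eulerIntegral hα, fun z hz => ?_⟩
  rw [ordinaryHypergeometric_one_eq_tsum hα, eulerIntegral_eq_tsum hα (by simpa using hz)]

/-! ### The contribution of one segment as an integral -/

namespace SLPParams

variable (P : SLPParams)

/-- The probability `1 - E[exp (-s H (τ r)^(-α) ρ)]`, as a function of the distance `r`. -/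
noncomputable def outage (s r : ℝ) : ℝ := (1 + (P.tau * r) ^ P.alpha / (s * P.rho))⁻¹

/-- The argument is a nonpositive real `-w`, so it lies in the cut plane however large `w` is, even
where the Gauss series diverges. Euler's integral there becomes the right-hand side under `r = m t`.
-/
lemma hyperTerm_eq_integral {s m : ℝ} (hs : 0 < s) (hm : 0 ≤ m) :
    P.hyperTerm s m = ∫ r in (0 : ℝ)..m, P.outage s r := by
  have hρ := P.rho_pos
  have hτ := P.tau_pos
  have hα := P.alpha_pos
  set w : ℝ := (P.tau * m) ^ P.alpha / (s * P.rho) with hw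
  have hw0 : 0 ≤ w := by positivity
  have hz : (P.tau * m) ^ P.alpha / (-(s * P.rho)) = -w := by rw [hw, div_neg]
  have hmem : ((-w : ℝ) : ℂ) ∈ hypergeometricDomain := by
    change 1 - ((-w : ℝ) : ℂ) ∈ Complex.slitPlane
    rw [Complex.mem_slitPlane_iff]
    left
    simp only [Complex.sub_re, Complex.one_re, Complex.ofReal_re]
    linarith
  have hint : eulerIntegral P.alpha ((-w : ℝ) : ℂ) =
      ((∫ t in (0 : ℝ)..1, (1 + w * t ^ P.alpha)⁻¹ : ℝ) : ℂ) := by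
    rw [eulerIntegral, ← intervalIntegral.integral_ofReal]
    refine intervalIntegral.integral_congr fun t _ => ?_
    push_cast
    ring
  rw [hyperTerm, hz, gaussHypergeometric_eqOn (isGaussHypergeometric_eulerIntegral hα) hmem, hint,
    Complex.ofReal_re]
  have hsub := intervalIntegral.mul_integral_comp_mul_left (a := 0) (b := 1)
    (f := P.outage s) (c := m)
  rw [mul_zero, mul_one] at hsub
  rw [← hsub]
  congr 1
  refine intervalIntegral.integral_congr fun t ht => ?_
  rw [Set.uIcc_of_le zero_le_one] at ht
  simp only [outage]
  rw [hw, ← mul_assoc P.tau, Real.mul_rpow (by positivity) ht.1, div_mul_eq_mul_div]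

end SLPParams

namespace SLPParams

variable (P : SLPParams)

lemma dC_pos : 0 < P.dC := mul_pos (Nat.cast_pos.2 P.nAR_pos) P.dA_pos

lemma dA_le_dC : P.dA ≤ P.dC :=
  le_mul_of_one_le_left P.dA_pos.le (by exact_mod_cast P.nAR_pos)

lemma continuous_outage_abs {s : ℝ} (hs : 0 < s) : Continuous fun r => P.outage s |r| := by
  have hρ := P.rho_pos
  have hτ := P.tau_pos
  have hα := P.alpha_pos
  have h : Continuous fun r : ℝ => 1 + (P.tau * |r|) ^ P.alpha / (s * P.rho) :=
    continuous_const.add (((continuous_const.mul continuous_abs).rpow_const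
      fun _ => Or.inr hα.le).div_const _)
  exact h.inv₀ fun r => by positivity

lemma outage_abs_mem_Icc {s : ℝ} (hs : 0 < s) (r : ℝ) : P.outage s |r| ∈ Set.Icc 0 1 := by
  have hρ := P.rho_pos
  have hτ := P.tau_pos
  have h : 0 ≤ (P.tau * |r|) ^ P.alpha / (s * P.rho) := by positivity
  exact ⟨inv_nonneg.2 (by linarith), inv_le_one_of_one_le₀ (by linarith)⟩

lemma hyperTerm_eq_integral_abs {s m : ℝ} (hs : 0 < s) (hm : 0 ≤ m) :
    P.hyperTerm s m = ∫ r in (0 : ℝ)..m, P.outage s |r| := by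
  rw [P.hyperTerm_eq_integral hs hm]
  refine intervalIntegral.integral_congr fun r hr => ?_
  rw [Set.uIcc_of_le hm] at hr
  simp only [abs_of_nonneg hr.1]

lemma kappa_eq_zero {c : ℤ} {s x : ℝ} (h : P.dmax + P.dA / 2 ≤ |c * P.dC - x|) :
    P.kappa c s x = 0 := by
  have hA := P.dA_pos
  have hd := P.dmax_pos
  have h1 : ¬ P.muL1 c x < P.muU1 c x := by
    simp only [muL1, muU1, muU2, neg_neg, not_lt]
    rcases le_abs'.1 h with h | h
    · exact (min_le_left _ _).trans ((by linarith : _ ≤ (0 : ℝ)).trans (le_max_right _ _))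
    · exact (min_le_right _ _).trans
        ((by linarith : _ ≤ c * P.dC - P.dA / 2 - x).trans
          ((le_max_left _ _).trans (le_max_left _ _)))
  have h2 : ¬ P.muL2 c x < P.muU2 c x := by
    simp only [muL2, muU1, muU2, not_lt, neg_le_neg_iff]
    rcases le_abs'.1 h with h | h
    · exact (min_le_left _ _).trans ((min_le_left _ _).trans
        ((by linarith : _ ≤ -P.dmax).trans (le_max_right _ _)))
    · exact (min_le_right _ _).trans
        ((by linarith : _ ≤ c * P.dC - P.dA / 2 - x).trans (le_max_left _ _))
  simp [kappa, h1, h2]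

lemma integral_outage_sub_of_nonneg {s p q : ℝ} (hs : 0 < s) (hp : 0 ≤ p) (hq : 0 ≤ q) :
    P.hyperTerm s q - P.hyperTerm s p = ∫ r in p..q, P.outage s |r| := by
  have hi := fun a b => (P.continuous_outage_abs hs).intervalIntegrable (μ := volume) a b
  rw [P.hyperTerm_eq_integral_abs hs hp, P.hyperTerm_eq_integral_abs hs hq,
    intervalIntegral.integral_interval_sub_left (hi _ _) (hi _ _)]

lemma integral_outage_sub_neg {s p q : ℝ} (hs : 0 < s) (hp : p ≤ 0) (hq : q ≤ 0) :
    P.hyperTerm s (-p) - P.hyperTerm s (-q) = ∫ r in p..q, P.outage s |r| := by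
  rw [P.integral_outage_sub_of_nonneg hs (neg_nonneg.2 hq) (neg_nonneg.2 hp),
    ← intervalIntegral.integral_comp_neg]
  simp only [abs_neg]

/-- `κ(c, s, x)` as an integral over the range of distances to the `c`-th segment. -/
lemma kappa_eq_integral_distance {s : ℝ} (hs : 0 < s) (c : ℤ) (x : ℝ) :
    P.kappa c s x = ∫ r in Set.Ioc (-P.muU2 c x) (P.muU1 c x), P.outage s |r| := by
  have hi := fun a b => (P.continuous_outage_abs hs).intervalIntegrable (μ := volume) a b
  have hz : P.hyperTerm s 0 = 0 := by simp [hyperTerm]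
  unfold kappa muL1 muL2
  obtain ⟨l, hl⟩ : ∃ l, l = -P.muU2 c x := ⟨_, rfl⟩
  have hl' : P.muU2 c x = -l := by rw [hl, neg_neg]
  rw [hl', neg_neg]
  generalize P.muU1 c x = u
  rcases le_or_gt u l with h | h
  · rw [if_neg (not_lt.2 (h.trans (le_max_left _ _))),
      if_neg (not_lt.2 (neg_le_neg ((min_le_left _ _).trans h))), Set.Ioc_eq_empty (not_lt.2 h)]
    simp
  rw [← intervalIntegral.integral_of_le h.le]
  -- The position of `0` relative to `(l, u]` decides which terms of `κ` survive: `j = 1` covers the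
  -- positive displacements, `j = 2` the negative ones after reflection. If `0` is interior, both
  -- lower limits are `0`.
  rcases le_or_gt 0 l with h0 | h0
  · have hu : 0 < u := h0.trans_lt h
    rw [max_eq_left h0, if_pos h, min_eq_right hu.le, if_neg (by simpa using h0),
      P.integral_outage_sub_of_nonneg hs h0 hu.le, add_zero]
  rw [max_eq_right h0.le]
  rcases le_or_gt u 0 with hu | hu
  · rw [if_neg (not_lt.2 hu), min_eq_left hu, if_pos (neg_lt_neg h),
      P.integral_outage_sub_neg hs h0.le hu, zero_add]
  · rw [if_pos hu, min_eq_right hu.le, if_pos (by simpa using h0),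
      P.integral_outage_sub_neg hs h0.le le_rfl, P.integral_outage_sub_of_nonneg hs le_rfl hu.le,
      add_comm, intervalIntegral.integral_add_adjacent_intervals (hi _ _) (hi _ _)]

lemma measurableSet_segment (c : ℤ) : MeasurableSet (P.segment c) :=
  measurableSet_Ico (a := c * P.dC - P.dA / 2) (b := c * P.dC + P.dA / 2)

lemma measurableSet_cochannel : MeasurableSet P.cochannel :=
  MeasurableSet.iUnion P.measurableSet_segment

/-- Centres are at least `dC ≥ dA` apart. Half-open segments are needed when `nAR = 1`, since
neighbours then abut. -/
lemma pairwise_disjoint_segment : Pairwise (Function.onFun Disjoint P.segment) := by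
  intro c c' hne
  wlog hlt : c < c' generalizing c c'
  · exact (this hne.symm (lt_of_le_of_ne (not_lt.1 hlt) hne.symm)).symm
  refine Set.disjoint_left.2 fun y hy hy' => ?_
  have h1 : (c : ℝ) + 1 ≤ c' := by exact_mod_cast hlt
  have h2 := mul_le_mul_of_nonneg_right h1 P.dC_pos.le
  have h3 := P.dA_le_dC
  have h4 := hy.2
  have h5 := hy'.1
  linarith

lemma kappa_eq_integral {s : ℝ} (hs : 0 < s) (c : ℤ) (x : ℝ) :
    P.kappa c s x = ∫ y in P.segment c ∩ Metric.ball x P.dmax, P.outage s |y - x| := by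
  -- The two intervals differ only in which endpoints they contain, so discarding the four possible
  -- endpoints makes them equal.
  have hset : (P.segment c ∩ Metric.ball x P.dmax : Set ℝ) =ᵐ[volume]
      ((fun y => y - x) ⁻¹' Set.Ioc (-P.muU2 c x) (P.muU1 c x) : Set ℝ) := by
    have hae : ∀ a : ℝ, ∀ᵐ y : ℝ, y ≠ a := fun a => by simp [ae_iff]
    filter_upwards [hae (c * P.dC - P.dA / 2), hae (c * P.dC + P.dA / 2), hae (x - P.dmax),
      hae (x + P.dmax)] with y h1 h2 h3 h4
    refine propext ?_
    change (y ∈ P.segment c ∧ y ∈ Metric.ball x P.dmax) ↔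
      (-P.muU2 c x < y - x ∧ y - x ≤ P.muU1 c x)
    rw [Metric.mem_ball, Real.dist_eq, abs_lt, muU1, muU2, neg_neg, max_lt_iff, le_min_iff]
    change ((_ ≤ _ ∧ _ < _) ∧ _) ↔ _
    constructor
    · rintro ⟨⟨h5, h6⟩, h7, h8⟩
      have := lt_of_le_of_ne h5 (Ne.symm h1)
      refine ⟨⟨?_, ?_⟩, ?_, ?_⟩ <;> linarith
    · rintro ⟨⟨h5, h6⟩, h7, h8⟩
      have h9 : y < c * P.dC + P.dA / 2 := lt_of_le_of_ne (by linarith) h2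
      have h10 : y < x + P.dmax := lt_of_le_of_ne (by linarith) h4
      refine ⟨⟨?_, ?_⟩, ?_, ?_⟩ <;> linarith
  rw [setIntegral_congr_set hset, P.kappa_eq_integral_distance hs]
  exact ((measurePreserving_sub_right volume x).setIntegral_preimage_emb
    (MeasurableEquiv.subRight x).measurableEmbedding (fun r => P.outage s |r|) _).symm

lemma finite_support_kappa (s x : ℝ) : (Function.support fun c : ℤ => P.kappa c s x).Finite := by
  have hC := P.dC_pos
  refine (Set.finite_Icc ⌊(x - (P.dmax + P.dA / 2)) / P.dC⌋
    ⌈(x + (P.dmax + P.dA / 2)) / P.dC⌉).subset fun c hc => ?_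
  have h := abs_lt.1 (not_le.1 (mt (P.kappa_eq_zero (s := s)) hc))
  constructor
  · have : (⌊(x - (P.dmax + P.dA / 2)) / P.dC⌋ : ℝ) ≤ c :=
      (Int.floor_le _).trans ((div_le_iff₀ hC).2 (by linarith))
    exact_mod_cast this
  · have : (c : ℝ) ≤ ⌈(x + (P.dmax + P.dA / 2)) / P.dC⌉ :=
      ((le_div_iff₀ hC).2 (by linarith)).trans (Int.le_ceil _)
    exact_mod_cast this

/-- The region in which an active vehicle interferes at `x`. -/
def region (x : ℝ) : Set ℝ := P.cochannel ∩ Metric.ball x P.dmax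

lemma measurableSet_region (x : ℝ) : MeasurableSet (P.region x) :=
  P.measurableSet_cochannel.inter Metric.isOpen_ball.measurableSet

lemma volume_region_ne_top (x : ℝ) : volume (P.region x) ≠ ⊤ :=
  measure_ne_top_of_subset Set.inter_subset_right measure_ball_lt_top.ne

lemma integrableOn_outage {s : ℝ} (hs : 0 < s) (x : ℝ) :
    IntegrableOn (fun y => P.outage s |y - x|) (P.region x) :=
  Measure.integrableOn_of_bounded (P.volume_region_ne_top x)
    ((P.continuous_outage_abs hs).comp (continuous_sub_right x)).aestronglyMeasurable
    (Filter.Eventually.of_forall fun y => by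
      have := P.outage_abs_mem_Icc hs (y - x)
      rw [Real.norm_of_nonneg this.1]
      exact this.2)

theorem integral_region_eq_finsum_kappa {s : ℝ} (hs : 0 < s) (x : ℝ) :
    ∫ y in P.region x, P.outage s |y - x| = ∑ᶠ c : ℤ, P.kappa c s x := by
  have hU : P.region x = ⋃ c : ℤ, P.segment c ∩ Metric.ball x P.dmax := by
    rw [region, cochannel, Set.iUnion_inter]
  have hint := P.integrableOn_outage hs x
  rw [hU] at hint ⊢
  rw [integral_iUnion (fun c => (P.measurableSet_segment c).inter Metric.isOpen_ball.measurableSet)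
    (fun c c' h => (P.pairwise_disjoint_segment h).mono Set.inter_subset_left
      Set.inter_subset_left) hint, ← tsum_eq_finsum (L := .unconditional ℤ) (P.finite_support_kappa s x)]
  exact tsum_congr fun c => (P.kappa_eq_integral hs c x).symm

/-- The hypotheses place the near ends of segments `-(m + 1)` and `n + 1` at distance at least
`dmax` from `x`, on the left and on the right. These segments and all those further out contribute
nothing. -/
lemma finsum_kappa_eq_sum {s x : ℝ} {m n : ℤ}
    (hm : P.dmax - x ≤ (m + 1) * P.dC - P.dA / 2) (hn : P.dmax + x ≤ (n + 1) * P.dC - P.dA / 2) :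
    ∑ᶠ c : ℤ, P.kappa c s x = ∑ c ∈ Finset.Icc (-m) n, P.kappa c s x := by
  refine finsum_eq_sum_of_support_subset _ fun c hc => ?_
  rw [Finset.coe_Icc]
  have h := abs_lt.1 (not_le.1 (mt (P.kappa_eq_zero (s := s)) hc))
  constructor
  · by_contra! hlt
    have h1 : (c : ℝ) ≤ -(m + 1) := by exact_mod_cast (by omega : c ≤ -(m + 1))
    have := mul_le_mul_of_nonneg_right h1 P.dC_pos.le
    linarith
  · by_contra! hlt
    have h1 : (n : ℝ) + 1 ≤ c := by exact_mod_cast hlt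
    have := mul_le_mul_of_nonneg_right h1 P.dC_pos.le
    linarith

end SLPParams

/-! ### Products with finitely many nontrivial factors -/

section FiniteProducts

open Filter Topology

/-- The partial products are eventually constant. This transfers measurability and limit theorems to
`∏ᶠ`, whose support is random in the applications. -/
lemma tendsto_prod_range_finprod {M : Type*} [CommMonoid M] [TopologicalSpace M] {f : ℕ → M}
    (hf : (Function.mulSupport f).Finite) :
    Tendsto (fun n => ∏ i ∈ Finset.range n, f i) atTop (𝓝 (∏ᶠ i, f i)) := by
  obtain ⟨N, hN⟩ := hf.bddAbove
  refine tendsto_const_nhds.congr' ?_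
  filter_upwards [eventually_gt_atTop N] with n hn
  refine finprod_eq_prod_of_mulSupport_subset f fun i hi => ?_
  exact Finset.mem_coe.2 (Finset.mem_range.2 ((hN hi).trans_lt hn))

lemma aemeasurable_finprod_of_finite {Ω : Type*} [MeasurableSpace Ω] {μ : Measure Ω}
    {f : ℕ → Ω → ENNReal} (hf : ∀ i, AEMeasurable (f i) μ)
    (hfin : ∀ᵐ ω ∂μ, (Function.mulSupport fun i => f i ω).Finite) :
    AEMeasurable (fun ω => ∏ᶠ i, f i ω) μ :=
  aemeasurable_of_tendsto_metrizable_ae atTop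
    (fun n => Finset.aemeasurable_fun_prod (Finset.range n) fun i _ => hf i)
    (hfin.mono fun _ h => tendsto_prod_range_finprod h)

end FiniteProducts

/-! ### The Laplace functional of a Poisson process -/

section Poisson

open Filter Topology

variable {Ω : Type*} [MeasurableSpace Ω] {μ : Measure Ω} {X : ℕ → Ω → ℝ} {lam : ℝ}

lemma lintegral_pow_poissonMeasure (r : NNReal) {v : ENNReal} (hv : v ≠ ⊤) :
    ∫⁻ n, v ^ n ∂(poissonMeasure r) = ENNReal.ofReal (Real.exp (r * (v.toReal - 1))) := by
  lift v to NNReal using hv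
  have hsum : HasSum (fun n : ℕ => Real.exp (-r) * (r * v : ℝ) ^ n / n.factorial)
      (Real.exp (r * ((v : ℝ) - 1))) := by
    have h := (NormedSpace.expSeries_div_hasSum_exp ((r : ℝ) * v)).mul_left (Real.exp (-r))
    rw [← Real.exp_eq_exp_ℝ, ← Real.exp_add] at h
    convert! h using 1
    · simp_rw [mul_div_assoc]
    · congr 1
      ring
  rw [ENNReal.coe_toReal, ← hsum.tsum_eq,
    ENNReal.ofReal_tsum_of_nonneg (fun n => by positivity) hsum.summable, poissonMeasure,
    lintegral_sum_measure]
  refine tsum_congr fun n => ?_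
  rw [lintegral_smul_measure, lintegral_dirac, smul_eq_mul, ← ENNReal.ofReal_coe_nnreal,
    ← ENNReal.ofReal_pow (NNReal.coe_nonneg v), ← ENNReal.ofReal_mul (by positivity), mul_pow]
  congr 1
  ring

namespace IsPoissonPointProcess

lemma measurable_pointCount (hX : IsPoissonPointProcess μ X lam) {B : Set ℝ}
    (hB : MeasurableSet B) : Measurable (pointCount X B) := by
  refine measurable_encard.comp (measurable_set_iff.2 fun i => ?_)
  exact measurableSet_setOfPred.1 (hX.measurable i hB)

/-- The count law prescribes only the masses of finite values. These add up to `1`, so nothing is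
left for `⊤`; this is what makes the point process locally finite. -/
lemma map_pointCount [IsProbabilityMeasure μ] (hX : IsPoissonPointProcess μ X lam) {B : Set ℝ}
    (hB : MeasurableSet B) (hB' : volume B ≠ ⊤) :
    μ.map (pointCount X B) =
      (poissonMeasure (lam * (volume B).toReal).toNNReal).map (Nat.cast : ℕ → ℕ∞) := by
  have hm := hX.measurable_pointCount hB
  set ν := poissonMeasure (lam * (volume B).toReal).toNNReal
  have hν : IsProbabilityMeasure (ν.map (Nat.cast : ℕ → ℕ∞)) :=
    Measure.isProbabilityMeasure_map .of_discrete
  have hμ : IsProbabilityMeasure (μ.map (pointCount X B)) :=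
    Measure.isProbabilityMeasure_map hm.aemeasurable
  have hn : ∀ n : ℕ, μ.map (pointCount X B) {(n : ℕ∞)} = ν.map (Nat.cast : ℕ → ℕ∞) {(n : ℕ∞)} := by
    intro n
    rw [Measure.map_apply hm .of_discrete, Measure.map_apply .of_discrete .of_discrete]
    have h : (Nat.cast : ℕ → ℕ∞) ⁻¹' {(n : ℕ∞)} = {n} := by ext k; simp
    rw [h, ← hX.count_law B hB hB' n]
    rfl
  have hfin : μ.map (pointCount X B) {⊤}ᶜ = ν.map (Nat.cast : ℕ → ℕ∞) {⊤}ᶜ := by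
    have h : ({⊤}ᶜ : Set ℕ∞) = ⋃ n : ℕ, {(n : ℕ∞)} := by
      ext k
      simp
    have hd : Pairwise (Function.onFun Disjoint fun n : ℕ => ({(n : ℕ∞)} : Set ℕ∞)) := by
      intro m n hmn
      simpa [Function.onFun] using hmn
    rw [h, measure_iUnion hd fun _ => .of_discrete, measure_iUnion hd fun _ => .of_discrete]
    exact tsum_congr hn
  refine Measure.ext_of_singleton fun k => ?_
  induction k using ENat.recTopCoe with
  | coe n => exact hn n
  | top =>
    have h : ∀ (ρ : Measure ℕ∞) [IsProbabilityMeasure ρ], ρ {⊤} = 1 - ρ {⊤}ᶜ := fun ρ _ => by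
      rw [← prob_compl_eq_one_sub .of_discrete, compl_compl]
    rw [h, h, hfin]

lemma ae_finite [IsProbabilityMeasure μ] (hX : IsPoissonPointProcess μ X lam) {B : Set ℝ}
    (hB : MeasurableSet B) (hB' : volume B ≠ ⊤) : ∀ᵐ ω ∂μ, {i | X i ω ∈ B}.Finite := by
  have h : ∀ᵐ k ∂(μ.map (pointCount X B)), k ≠ ⊤ := by
    rw [hX.map_pointCount hB hB', ae_map_iff .of_discrete .of_discrete]
    exact ae_of_all _ fun n => ENat.natCast_ne_top n
  filter_upwards [ae_of_ae_map (hX.measurable_pointCount hB).aemeasurable h] with ω hω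
  exact Set.encard_ne_top_iff.1 hω

lemma lintegral_pow_pointCount [IsProbabilityMeasure μ] (hX : IsPoissonPointProcess μ X lam)
    (hlam : 0 ≤ lam) {B : Set ℝ} (hB : MeasurableSet B) (hB' : volume B ≠ ⊤) {v : ENNReal}
    (hv : v ≠ ⊤) :
    ∫⁻ ω, v ^ (pointCount X B ω).toNat ∂μ =
      ENNReal.ofReal (Real.exp (lam * (volume B).toReal * (v.toReal - 1))) := by
  rw [← lintegral_map (μ := μ) (f := fun k : ℕ∞ => v ^ k.toNat) .of_discrete
    (hX.measurable_pointCount hB), hX.map_pointCount hB hB', lintegral_map .of_discrete .of_discrete]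
  simp only [ENat.toNat_natCast]
  rw [lintegral_pow_poissonMeasure _ hv, Real.coe_toNNReal _ (by positivity)]

lemma lintegral_finprod_simpleFunc [IsProbabilityMeasure μ] (hX : IsPoissonPointProcess μ X lam)
    (hlam : 0 ≤ lam) {W : Set ℝ} (hW : MeasurableSet W) (hW' : volume W ≠ ⊤)
    (h : SimpleFunc ℝ ENNReal) (htop : ∀ y, h y ≠ ⊤) (hone : ∀ y ∉ W, h y = 1) :
    ∫⁻ ω, ∏ᶠ i, h (X i ω) ∂μ = ENNReal.ofReal
      (Real.exp (lam * ((∫⁻ y in W, h y).toReal - (volume W).toReal))) := by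
  classical
  let e : Fin h.range.card ≃ h.range := h.range.equivFin.symm
  -- Level sets are cut down to `W` to have finite volume; points outside `W` contribute the factor
  -- `1`. The counts in these disjoint sets are independent, so the expectation factors into Poisson
  -- generating functions.
  let B : ENNReal → Set ℝ := fun v => h ⁻¹' {v} ∩ W
  have hBm : ∀ v, MeasurableSet (B v) := fun v => (h.measurableSet_fiber v).inter hW
  have hBtop : ∀ v, volume (B v) ≠ ⊤ := fun v => measure_ne_top_of_subset Set.inter_subset_right hW'
  have hvtop : ∀ v ∈ h.range, v ≠ ⊤ := by
    intro v hv
    obtain ⟨y, rfl⟩ := SimpleFunc.mem_range.1 hv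
    exact htop y
  have hprod : ∀ᵐ ω ∂μ, ∏ᶠ i, h (X i ω) =
      ∏ j, ((e j : ENNReal)) ^ (pointCount X (B (e j)) ω).toNat := by
    filter_upwards [hX.ae_finite hW hW'] with ω hω
    rw [e.prod_comp fun v : h.range => (v : ENNReal) ^ (pointCount X (B v) ω).toNat,
      Finset.prod_coe_sort h.range fun v : ENNReal => v ^ (pointCount X (B v) ω).toNat,
      finprod_eq_prod_of_mulSupport_subset (s := hω.toFinset) _ fun i hi => by
        by_contra hi'
        exact hi (hone _ (by simpa using hi')),
      ← Finset.prod_fiberwise_of_maps_to' (t := h.range) (g := fun i => h (X i ω))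
        (fun i _ => SimpleFunc.mem_range_self h _) fun v => v]
    refine Finset.prod_congr rfl fun v _ => ?_
    rw [Finset.prod_const]
    congr 1
    have hset : {i | X i ω ∈ B v} = ((hω.toFinset.filter fun i => h (X i ω) = v : Finset ℕ) :
        Set ℕ) := by
      ext i
      simp [B, and_comm]
    rw [pointCount, hset, Set.encard_coe_eq_coe_finsetCard, ENat.toNat_natCast]
  have hind : iIndepFun (fun j => pointCount X (B (e j))) μ := by
    refine hX.count_indep _ (fun j => B (e j)) (fun j => hBm _) fun i j hij => ?_
    refine Set.disjoint_left.2 fun y hy hy' => hij (e.injective (Subtype.ext ?_))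
    exact (hy.1 : h y = e i).symm.trans hy'.1
  have hind' : iIndepFun (fun j ω => (e j : ENNReal) ^ (pointCount X (B (e j)) ω).toNat) μ :=
    hind.comp (fun j (k : ℕ∞) => (e j : ENNReal) ^ k.toNat) fun j => .of_discrete
  rw [lintegral_congr_ae hprod, lintegral_prod_eq_prod_lintegral_of_indepFun Finset.univ _ hind'
    fun j => (Measurable.of_discrete (f := fun k : ℕ∞ => (e j : ENNReal) ^ k.toNat)).comp
      (hX.measurable_pointCount (hBm _))]
  rw [e.prod_comp fun v : h.range => ∫⁻ ω, (v : ENNReal) ^ (pointCount X (B v) ω).toNat ∂μ,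
      Finset.prod_coe_sort h.range fun v : ENNReal =>
        ∫⁻ ω, v ^ (pointCount X (B v) ω).toNat ∂μ,
      Finset.prod_congr rfl fun v hv => hX.lintegral_pow_pointCount hlam (hBm v) (hBtop v)
        (hvtop v hv), ← ENNReal.ofReal_prod_of_nonneg fun _ _ => (Real.exp_pos _).le,
      ← Real.exp_sum]
  have hint : ∫⁻ y in W, h y = ∑ v ∈ h.range, v * volume (B v) := by
    rw [SimpleFunc.lintegral_eq_lintegral, SimpleFunc.lintegral]
    exact Finset.sum_congr rfl fun v _ => by rw [Measure.restrict_apply (h.measurableSet_fiber v)]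
  have hvol : volume W = ∑ v ∈ h.range, volume (B v) := by
    rw [← Measure.restrict_apply_univ, ← h.sum_range_measure_preimage_singleton]
    exact Finset.sum_congr rfl fun v _ => by rw [Measure.restrict_apply (h.measurableSet_fiber v)]
  rw [hint, hvol, ENNReal.toReal_sum fun v hv => ENNReal.mul_ne_top (hvtop v hv) (hBtop v),
    ENNReal.toReal_sum fun v _ => hBtop v, ← Finset.sum_sub_distrib, Finset.mul_sum]
  congr 2
  refine Finset.sum_congr rfl fun v _ => ?_
  rw [ENNReal.toReal_mul]
  ring

/-- The Laplace functional of a Poisson point process. -/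
theorem lintegral_finprod [IsProbabilityMeasure μ] (hX : IsPoissonPointProcess μ X lam)
    (hlam : 0 ≤ lam) {W : Set ℝ} (hW : MeasurableSet W) (hW' : volume W ≠ ⊤)
    {h : ℝ → ENNReal} (hm : Measurable h) {C : ENNReal} (hC : C ≠ ⊤) (hle : ∀ y, h y ≤ C)
    (hone : ∀ y ∉ W, h y = 1) :
    ∫⁻ ω, ∏ᶠ i, h (X i ω) ∂μ = ENNReal.ofReal
      (Real.exp (lam * ((∫⁻ y in W, h y).toReal - (volume W).toReal))) := by
  classical
  -- The approximants increase to `h` but are set to `1` off `W`, so that every product remains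
  -- finite and monotone convergence applies.
  let f : ℕ → SimpleFunc ℝ ENNReal := fun n =>
    SimpleFunc.piecewise W hW (SimpleFunc.eapprox h n) (SimpleFunc.const ℝ 1)
  have hf_mem : ∀ n, ∀ y ∈ W, f n y = SimpleFunc.eapprox h n y := fun n y hy => by
    simp [f, hy]
  have hf_notMem : ∀ n, ∀ y ∉ W, f n y = 1 := fun n y hy => by simp [f, hy]
  have hf_mono : ∀ y, Monotone fun n => f n y := by
    intro y m n hmn
    by_cases hy : y ∈ W
    · simp only [hf_mem _ y hy]
      exact SimpleFunc.monotone_eapprox h hmn y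
    · simp only [hf_notMem _ y hy, le_refl]
  have hf_tendsto : ∀ y, Tendsto (fun n => f n y) atTop (𝓝 (h y)) := by
    intro y
    by_cases hy : y ∈ W
    · simp only [hf_mem _ y hy]
      exact SimpleFunc.tendsto_eapprox hm y
    · simp only [hf_notMem _ y hy, hone y hy]
      exact tendsto_const_nhds
  have hh_top : ∀ y, h y ≠ ⊤ := fun y => ne_top_of_le_ne_top hC (hle y)
  have hf_top : ∀ n y, f n y ≠ ⊤ := fun n y =>
    ne_top_of_le_ne_top (hh_top y) ((hf_mono y).ge_of_tendsto (hf_tendsto y) n)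
  have hfinprod : ∀ {g : ℝ → ENNReal}, (∀ y ∉ W, g y = 1) → ∀ {ω : Ω} (hω : {i | X i ω ∈ W}.Finite),
      ∏ᶠ i, g (X i ω) = ∏ i ∈ hω.toFinset, g (X i ω) := fun hg ω hω =>
    finprod_eq_prod_of_mulSupport_subset _ fun i hi => by
      by_contra hi'
      exact hi (hg _ (by simpa using hi'))
  have hlim : Tendsto (fun n => ∫⁻ ω, ∏ᶠ i, f n (X i ω) ∂μ) atTop
      (𝓝 (∫⁻ ω, ∏ᶠ i, h (X i ω) ∂μ)) := by
    refine lintegral_tendsto_of_tendsto_of_monotone (fun n => ?_) ?_ ?_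
    · refine aemeasurable_finprod_of_finite
        (fun i => ((f n).measurable.comp (hX.measurable i)).aemeasurable) ?_
      filter_upwards [hX.ae_finite hW hW'] with ω hω
      exact hω.subset fun i hi => by_contra fun hi' => hi (hf_notMem n _ hi')
    · filter_upwards [hX.ae_finite hW hW'] with ω hω m n hmn
      simp only [hfinprod (hf_notMem _) hω]
      exact Finset.prod_le_prod' fun i _ => hf_mono _ hmn
    · filter_upwards [hX.ae_finite hW hW'] with ω hω
      simp only [hfinprod (hf_notMem _) hω, hfinprod hone hω]
      exact ENNReal.tendsto_finsetProd_of_ne_top _ (fun i _ => hf_tendsto _) fun i _ => hh_top _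
  refine tendsto_nhds_unique hlim ?_
  simp only [hX.lintegral_finprod_simpleFunc hlam hW hW' (f _) (hf_top _) (hf_notMem _)]
  have hint_top : ∫⁻ y in W, h y ≠ ⊤ := by
    refine ne_top_of_le_ne_top (ENNReal.mul_ne_top hC hW') ?_
    rw [← setLIntegral_const]
    exact lintegral_mono fun y => hle y
  have hint : Tendsto (fun n => ∫⁻ y in W, f n y) atTop (𝓝 (∫⁻ y in W, h y)) :=
    lintegral_tendsto_of_tendsto_of_monotone (fun n => (f n).measurable.aemeasurable)
      (ae_of_all _ hf_mono) (ae_of_all _ hf_tendsto)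
  exact ENNReal.tendsto_ofReal ((Real.continuous_exp.tendsto _).comp
    ((((ENNReal.tendsto_toReal hint_top).comp hint).sub_const _).const_mul lam))

end IsPoissonPointProcess

end Poisson

/-! ### The Mecke formula by first-order expansion -/

section Poisson

open Filter Topology

/-- A Taylor expansion in `t` written without subtraction. The remainder `R` depends on `t`, but the
value of the product at `t = 1` bounds it uniformly. -/
lemma exists_prod_add_mul_eq {ι : Type*} [DecidableEq ι] (s : Finset ι) (a b : ι → ENNReal)
    {t : ENNReal} (ht : t ≤ 1) :
    ∃ R, ∏ i ∈ s, (a i + t * b i) = ∏ i ∈ s, a i +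
        t * ∑ k ∈ s, ∏ i ∈ s, (if i = k then b i else a i) + t ^ 2 * R ∧
      ∏ i ∈ s, a i + ∑ k ∈ s, ∏ i ∈ s, (if i = k then b i else a i) + R ≤
        ∏ i ∈ s, (a i + b i) := by
  induction s using Finset.induction_on with
  | empty => exact ⟨0, by simp⟩
  | insert j s hj ih =>
    obtain ⟨R, hR, hR'⟩ := ih
    have hsum : ∑ k ∈ insert j s, ∏ i ∈ insert j s, (if i = k then b i else a i) =
        b j * ∏ i ∈ s, a i + a j * ∑ k ∈ s, ∏ i ∈ s, (if i = k then b i else a i) := by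
      rw [Finset.sum_insert hj, Finset.prod_insert hj, if_pos rfl, Finset.mul_sum]
      congr 1
      · congr 1
        refine Finset.prod_congr rfl fun i hi => if_neg ?_
        rintro rfl
        exact hj hi
      · refine Finset.sum_congr rfl fun k hk => ?_
        rw [Finset.prod_insert hj, if_neg]
        rintro rfl
        exact hj hk
    rw [hsum]
    simp only [Finset.prod_insert hj]
    set p := ∏ i ∈ s, a i
    set σ := ∑ k ∈ s, ∏ i ∈ s, (if i = k then b i else a i)
    -- These are the terms of order at least two, divided by `t ^ 2`, in `(a j + t * b j) * (p + t *
    -- σ + t ^ 2 * R)`.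
    refine ⟨a j * R + b j * σ + t * (b j * R), ?_, ?_⟩
    · rw [hR]
      ring
    · calc _ ≤ a j * p + (b j * p + a j * σ) + (a j * R + b j * σ + 1 * (b j * R)) := by gcongr
        _ = (a j + b j) * (p + σ + R) := by ring
        _ ≤ _ := by gcongr

/-- The difference quotient of `p * exp (t m)` at `0` lies between `σ` and `σ + t q`; let `t`
decrease to `0`. -/
lemma eq_of_exp_sandwich {p m σ q : ℝ}
    (h : ∀ t : ℝ, 0 < t → t ≤ 1 → p + t * σ ≤ p * Real.exp (t * m) ∧
      p * Real.exp (t * m) ≤ p + t * σ + t ^ 2 * q) : σ = p * m := by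
  have hd : HasDerivAt (fun t : ℝ => p * Real.exp (t * m)) (p * m) 0 := by
    simpa using (((hasDerivAt_id (0 : ℝ)).mul_const m).exp).const_mul p
  have hslope := (hasDerivAt_iff_tendsto_slope.1 hd).mono_left
    (nhdsWithin_mono (0 : ℝ) (fun t (ht : t ∈ Set.Ioi (0 : ℝ)) => (ne_of_gt ht : t ≠ 0)))
  have hev : ∀ᶠ t : ℝ in 𝓝[>] 0, 0 < t ∧ t ≤ 1 := by
    filter_upwards [Ioc_mem_nhdsGT (zero_lt_one' ℝ)] with t ht using ht
  have hslope_eq : ∀ t : ℝ, slope (fun t : ℝ => p * Real.exp (t * m)) 0 t =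
      (p * Real.exp (t * m) - p) / t := fun t => by simp [slope_def_field]
  refine tendsto_nhds_unique (f := fun t : ℝ => σ) (l := 𝓝[>] (0 : ℝ)) tendsto_const_nhds ?_
  have hq : Tendsto (fun t : ℝ => slope (fun t : ℝ => p * Real.exp (t * m)) 0 t - t * q) (𝓝[>] 0)
      (𝓝 (p * m)) := by
    have : Tendsto (fun t : ℝ => t * q) (𝓝[>] 0) (𝓝 (0 * q)) :=
      (tendsto_nhdsWithin_of_tendsto_nhds tendsto_id).mul_const q
    simpa using hslope.sub this
  refine tendsto_of_tendsto_of_tendsto_of_le_of_le' hq hslope ?_ ?_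
  · filter_upwards [hev] with t ht
    rw [hslope_eq, sub_le_iff_le_add, div_le_iff₀ ht.1]
    nlinarith [(h t ht.1 ht.2).2]
  · filter_upwards [hev] with t ht
    rw [hslope_eq, le_div_iff₀ ht.1]
    linarith [(h t ht.1 ht.2).1]

variable {Ω : Type*} [MeasurableSpace Ω] {μ : Measure Ω} {X : ℕ → Ω → ℝ} {lam : ℝ}

open Classical in
/-- The Mecke formula for products over a Poisson point process: the sum over the points `X k` in
`B` of the product of `g` over all other points. -/
theorem IsPoissonPointProcess.tsum_lintegral_finprod [IsProbabilityMeasure μ]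
    (hX : IsPoissonPointProcess μ X lam) (hlam : 0 ≤ lam) {W B : Set ℝ} (hW : MeasurableSet W)
    (hW' : volume W ≠ ⊤) (hB : MeasurableSet B) (hBW : B ⊆ W) {g : ℝ → ENNReal}
    (hm : Measurable g) (hle : ∀ y, g y ≤ 1) (hone : ∀ y ∉ W, g y = 1) :
    ∑' k, ∫⁻ ω, ∏ᶠ i, (if i = k then B.indicator 1 (X i ω) else g (X i ω)) ∂μ =
      ENNReal.ofReal (lam * (volume B).toReal) * ∫⁻ ω, ∏ᶠ i, g (X i ω) ∂μ := by
  let b : ℝ → ENNReal := B.indicator 1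
  have hbm : Measurable b := measurable_one.indicator hB
  have hb_le : ∀ y, b y ≤ 1 := fun y => Set.indicator_le_self' (fun _ _ => zero_le) y
  have hb_zero : ∀ y ∉ W, b y = 0 := fun y hy => Set.indicator_of_notMem (fun h => hy (hBW h)) _
  have hBtop : volume B ≠ ⊤ := measure_ne_top_of_subset hBW hW'
  have hfin := hX.ae_finite hW hW'
  have hfactor_one : ∀ k i ω, X i ω ∉ W → i ≠ k →
      (if i = k then b (X i ω) else g (X i ω)) = 1 := fun k i ω hi hik => by
    rw [if_neg hik, hone _ hi]
  let S : Ω → ENNReal := fun ω => ∑' k, ∏ᶠ i, (if i = k then b (X i ω) else g (X i ω))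
  have hterm_meas : ∀ k, AEMeasurable
      (fun ω => ∏ᶠ i, (if i = k then b (X i ω) else g (X i ω))) μ := by
    intro k
    refine aemeasurable_finprod_of_finite (fun i => ?_) ?_
    · by_cases h : i = k
      · simpa only [h, if_true, Function.comp_def] using (hbm.comp (hX.measurable k)).aemeasurable
      · simpa only [h, if_false, Function.comp_def] using (hm.comp (hX.measurable i)).aemeasurable
    · filter_upwards [hfin] with ω hω
      refine (hω.union (Set.finite_singleton k)).subset fun i hi => ?_
      by_contra hi'
      rw [Set.mem_union, not_or] at hi'
      exact hi (hfactor_one k i ω hi'.1 hi'.2)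
  -- An index `k` with `X k ω ∉ W` has vanishing `k`-th factor because `B ⊆ W`, so the series over
  -- `k` is a finite sum.
  have hS : ∀ ω (hω : {i | X i ω ∈ W}.Finite), S ω = ∑ k ∈ hω.toFinset, ∏ i ∈ hω.toFinset,
      (if i = k then b (X i ω) else g (X i ω)) := by
    intro ω hω
    have hsub : ∀ k, Function.mulSupport (fun i => if i = k then b (X i ω) else g (X i ω)) ⊆
        ↑(insert k hω.toFinset) := fun k i hi => by
      by_contra hi'
      rw [Finset.mem_coe, Finset.mem_insert, not_or] at hi'
      exact hi (hfactor_one k i ω (by simpa using hi'.2) hi'.1)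
    have hterm := fun k => finprod_eq_prod_of_mulSupport_subset _ (hsub k)
    change ∑' k, _ = _
    rw [tsum_eq_sum (s := hω.toFinset)]
    · refine Finset.sum_congr rfl fun k hk => ?_
      rw [hterm, Finset.insert_eq_of_mem hk]
    · intro k hk
      rw [hterm, Finset.prod_insert hk, if_pos rfl, hb_zero _ (by simpa using hk), zero_mul]
  -- The exponent of the Laplace functional is affine in the function, so adding `t 1_B` to `g`
  -- multiplies the value by `exp (t λ |B|)`.
  have hexp : ∀ t : ENNReal, t ≤ 1 → ∫⁻ ω, ∏ᶠ i, (g (X i ω) + t * b (X i ω)) ∂μ =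
      ENNReal.ofReal (Real.exp (lam * ((∫⁻ y in W, g y).toReal - (volume W).toReal)) *
        Real.exp (t.toReal * (lam * (volume B).toReal))) := by
    intro t ht
    have ht_top : t ≠ ⊤ := ne_top_of_le_ne_top ENNReal.one_ne_top ht
    have hgtop : ∫⁻ y in W, g y ≠ ⊤ := by
      refine ne_top_of_le_ne_top hW' ?_
      rw [← setLIntegral_one]
      exact lintegral_mono fun y => hle y
    rw [hX.lintegral_finprod hlam hW hW' (h := fun y => g y + t * b y)
      (hm.add (hbm.const_mul t)) (C := 1 + 1 * 1) (by norm_num)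
      (fun y => add_le_add (hle y) (mul_le_mul' ht (hb_le y)))
      (fun y hy => by simp [hone y hy, hb_zero y hy]), lintegral_add_left hm,
      lintegral_const_mul _ hbm, lintegral_indicator_one hB, Measure.restrict_apply hB,
      Set.inter_eq_left.2 hBW, ENNReal.toReal_add hgtop (ENNReal.mul_ne_top ht_top hBtop),
      ENNReal.toReal_mul, ← Real.exp_add]
    congr 2
    ring
  set p : ℝ := Real.exp (lam * ((∫⁻ y in W, g y).toReal - (volume W).toReal)) with hp
  set m : ℝ := lam * (volume B).toReal with hm_def
  set q : ℝ := p * Real.exp m with hq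
  have hF0 : ∫⁻ ω, ∏ᶠ i, g (X i ω) ∂μ = ENNReal.ofReal p := by
    simpa using hexp 0 zero_le_one
  have hF1 : ∫⁻ ω, ∏ᶠ i, (g (X i ω) + b (X i ω)) ∂μ = ENNReal.ofReal q := by
    simpa using hexp 1 le_rfl
  have hpt : ∀ᵐ ω ∂μ, ∀ t : ENNReal, t ≤ 1 →
      ∏ᶠ i, g (X i ω) + t * S ω ≤ ∏ᶠ i, (g (X i ω) + t * b (X i ω)) ∧
      ∏ᶠ i, (g (X i ω) + t * b (X i ω)) ≤
        ∏ᶠ i, g (X i ω) + t * S ω + t ^ 2 * ∏ᶠ i, (g (X i ω) + b (X i ω)) := by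
    filter_upwards [hfin] with ω hω t ht
    have hprod : ∀ f : ℕ → ENNReal, (∀ i, X i ω ∉ W → f i = 1) →
        ∏ᶠ i, f i = ∏ i ∈ hω.toFinset, f i := fun f hf =>
      finprod_eq_prod_of_mulSupport_subset _ fun i hi => by
        by_contra hi'
        exact hi (hf i (by simpa using hi'))
    obtain ⟨R, hR, hR'⟩ := exists_prod_add_mul_eq hω.toFinset (fun i => g (X i ω))
      (fun i => b (X i ω)) ht
    rw [hS ω hω, hprod _ fun i hi => hone _ hi,
      hprod (fun i => g (X i ω) + t * b (X i ω)) fun i hi => by simp [hone _ hi, hb_zero _ hi],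
      hprod (fun i => g (X i ω) + b (X i ω)) fun i hi => by simp [hone _ hi, hb_zero _ hi], hR]
    refine ⟨le_self_add, ?_⟩
    gcongr
    exact le_add_self.trans hR'
  have hF0_meas : AEMeasurable (fun ω => ∏ᶠ i, g (X i ω)) μ := by
    refine aemeasurable_finprod_of_finite (fun i => (hm.comp (hX.measurable i)).aemeasurable) ?_
    filter_upwards [hfin] with ω hω
    exact hω.subset fun i hi => by_contra fun hi' => hi (hone _ hi')
  have hS_meas : AEMeasurable S μ := AEMeasurable.tsum hterm_meas
  have hlin_meas : ∀ t : ENNReal, AEMeasurable (fun ω => ∏ᶠ i, g (X i ω) + t * S ω) μ :=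
    fun t => hF0_meas.add (hS_meas.const_mul t)
  have hsandwich : ∀ t : ENNReal, t ≤ 1 →
      ENNReal.ofReal p + t * ∫⁻ ω, S ω ∂μ ≤ ENNReal.ofReal (p * Real.exp (t.toReal * m)) ∧
      ENNReal.ofReal (p * Real.exp (t.toReal * m)) ≤
        ENNReal.ofReal p + t * ∫⁻ ω, S ω ∂μ + t ^ 2 * ENNReal.ofReal q := by
    intro t ht
    have ht_top : t ≠ ⊤ := ne_top_of_le_ne_top ENNReal.one_ne_top ht
    rw [← hexp t ht, ← hF0, ← hF1, ← lintegral_const_mul'' _ hS_meas,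
      ← lintegral_add_left' hF0_meas, ← lintegral_const_mul' _ _ (ENNReal.pow_ne_top ht_top),
      ← lintegral_add_left' (hlin_meas t)]
    exact ⟨lintegral_mono_ae (hpt.mono fun ω h => (h t ht).1),
      lintegral_mono_ae (hpt.mono fun ω h => (h t ht).2)⟩
  -- The lower bound at `t = 1` already forces finiteness, which permits the passage to real
  -- numbers.
  have hσ_top : ∫⁻ ω, S ω ∂μ ≠ ⊤ := by
    have h := (hsandwich 1 le_rfl).1
    rw [one_mul] at h
    exact ne_top_of_le_ne_top ENNReal.ofReal_ne_top (le_add_self.trans h)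
  have hp0 : 0 ≤ p := (Real.exp_pos _).le
  have hσ : (∫⁻ ω, S ω ∂μ).toReal = p * m := by
    refine eq_of_exp_sandwich (q := q) fun t ht0 ht1 => ?_
    have h := hsandwich (ENNReal.ofReal t) (by simpa using ht1)
    rw [← ENNReal.ofReal_toReal hσ_top, ENNReal.toReal_ofReal ht0.le, ← ENNReal.ofReal_pow ht0.le,
      ← ENNReal.ofReal_mul ht0.le, ← ENNReal.ofReal_mul (by positivity),
      ← ENNReal.ofReal_add hp0 (by positivity),
      ← ENNReal.ofReal_add (by positivity) (by positivity)] at h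
    rwa [ENNReal.ofReal_le_ofReal_iff (by positivity),
      ENNReal.ofReal_le_ofReal_iff (by positivity)] at h
  rw [hF0, ← ENNReal.ofReal_mul (by positivity), mul_comm m, ← hσ, ENNReal.ofReal_toReal hσ_top,
    lintegral_tsum hterm_meas]

end Poisson

/-! ### Integrating out independent marks -/

section Marks

open Filter Topology

variable {Ω α : Type*} [MeasurableSpace Ω] [MeasurableSpace α] {μ : Measure Ω}
  [IsProbabilityMeasure μ] {X : ℕ → Ω → ℝ} {M : ℕ → Ω → α}

/-- By independence the joint law of positions and marks is a product measure. Tonelli freezes the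
positions, and the independent marks then factor. -/
lemma lintegral_prod_marked (hXm : ∀ i, Measurable (X i)) (hMm : ∀ i, Measurable (M i))
    (hXM : IndepFun (fun ω i => X i ω) (fun ω i => M i ω) μ) (hM : iIndepFun M μ)
    {ψ : ℕ → ℝ × α → ENNReal} (hψ : ∀ i, Measurable (ψ i)) (s : Finset ℕ) :
    ∫⁻ ω, ∏ i ∈ s, ψ i (X i ω, M i ω) ∂μ =
      ∫⁻ ω, ∏ i ∈ s, ∫⁻ ω', ψ i (X i ω, M i ω') ∂μ ∂μ := by
  have hX' : Measurable fun ω i => X i ω := measurable_pi_lambda _ hXm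
  have hM' : Measurable fun ω i => M i ω := measurable_pi_lambda _ hMm
  have hlaw := (indepFun_iff_map_prod_eq_prod_map_map hX'.aemeasurable hM'.aemeasurable).1 hXM
  have hG : Measurable fun p : (ℕ → ℝ) × (ℕ → α) => ∏ i ∈ s, ψ i (p.1 i, p.2 i) := by
    refine Finset.measurable_fun_prod s fun i _ => (hψ i).comp ?_
    exact ((measurable_pi_apply i).comp measurable_fst).prodMk
      ((measurable_pi_apply i).comp measurable_snd)
  have hPX : IsProbabilityMeasure (μ.map fun ω i => X i ω) :=
    Measure.isProbabilityMeasure_map hX'.aemeasurable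
  have hPM : IsProbabilityMeasure (μ.map fun ω i => M i ω) :=
    Measure.isProbabilityMeasure_map hM'.aemeasurable
  rw [← lintegral_map (μ := μ) (f := fun p : (ℕ → ℝ) × (ℕ → α) => ∏ i ∈ s, ψ i (p.1 i, p.2 i)) hG
    (hX'.prodMk hM'), hlaw, lintegral_prod _ hG.aemeasurable,
    lintegral_map hG.lintegral_prod_right' hX']
  refine lintegral_congr fun ω => ?_
  have hGω : Measurable fun m : ℕ → α => ∏ i ∈ s, ψ i (X i ω, m i) :=
    hG.comp measurable_prodMk_left
  refine (lintegral_map hGω hM').trans ?_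
  exact lintegral_prod_eq_prod_lintegral_of_indepFun s _
    (hM.comp (fun i m => ψ i (X i ω, m)) fun i => (hψ i).comp measurable_prodMk_left)
    fun i => (hψ i).comp (measurable_const.prodMk (hMm i))

/-- Independent marks can be integrated out of a product over the points of a point process. -/
theorem lintegral_finprod_marked (hXm : ∀ i, Measurable (X i)) (hMm : ∀ i, Measurable (M i))
    (hXM : IndepFun (fun ω i => X i ω) (fun ω i => M i ω) μ) (hM : iIndepFun M μ)
    {ψ : ℕ → ℝ × α → ENNReal} (hψ : ∀ i, Measurable (ψ i))
    (hle : ∀ i, ∀ᵐ ω ∂μ, ∀ y, ψ i (y, M i ω) ≤ 1) {W : Set ℝ} {T : Set ℕ} (hT : T.Finite)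
    (hfin : ∀ᵐ ω ∂μ, {i | X i ω ∈ W}.Finite) (hone : ∀ i ∉ T, ∀ y ∉ W, ∀ m, ψ i (y, m) = 1) :
    ∫⁻ ω, ∏ᶠ i, ψ i (X i ω, M i ω) ∂μ = ∫⁻ ω, ∏ᶠ i, ∫⁻ ω', ψ i (X i ω, M i ω') ∂μ ∂μ := by
  have hgm : ∀ i, Measurable fun y => ∫⁻ ω', ψ i (y, M i ω') ∂μ := fun i =>
    ((hψ i).comp (measurable_fst.prodMk ((hMm i).comp measurable_snd))).lintegral_prod_right'
  have hgle : ∀ i y, ∫⁻ ω', ψ i (y, M i ω') ∂μ ≤ 1 := fun i y => by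
    calc _ ≤ ∫⁻ _, 1 ∂μ := lintegral_mono_ae ((hle i).mono fun ω h => h y)
      _ = 1 := by simp
  -- `T` allows for finitely many indices whose factor need not be `1` off `W`, such as the
  -- distinguished vehicle in the Mecke formula.
  have hsupp : ∀ ω, {i | X i ω ∈ W}.Finite → ∀ f : ℕ → ENNReal,
      (∀ i ∉ T, X i ω ∉ W → f i = 1) → (Function.mulSupport f).Finite := by
    intro ω hω f hf
    refine (hT.union hω).subset fun i hi => ?_
    by_contra hi'
    rw [Set.mem_union, not_or] at hi'
    exact hi (hf i hi'.1 hi'.2)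
  have h1 : Tendsto (fun n => ∫⁻ ω, ∏ i ∈ Finset.range n, ψ i (X i ω, M i ω) ∂μ) atTop
      (𝓝 (∫⁻ ω, ∏ᶠ i, ψ i (X i ω, M i ω) ∂μ)) := by
    refine tendsto_lintegral_of_dominated_convergence (fun _ => 1) (fun n => ?_) (fun n => ?_)
      (by simp) ?_
    · exact Finset.measurable_fun_prod _ fun i _ => (hψ i).comp ((hXm i).prodMk (hMm i))
    · filter_upwards [ae_all_iff.2 hle] with ω hω
      exact Finset.prod_le_one' fun i _ => hω i _
    · filter_upwards [hfin] with ω hω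
      exact tendsto_prod_range_finprod (hsupp ω hω _ fun i hi hi' => hone i hi _ hi' _)
  have h2 : Tendsto (fun n => ∫⁻ ω, ∏ i ∈ Finset.range n, ∫⁻ ω', ψ i (X i ω, M i ω') ∂μ ∂μ) atTop
      (𝓝 (∫⁻ ω, ∏ᶠ i, ∫⁻ ω', ψ i (X i ω, M i ω') ∂μ ∂μ)) := by
    refine tendsto_lintegral_of_dominated_convergence (fun _ => 1) (fun n => ?_) (fun n => ?_)
      (by simp) ?_
    · exact Finset.measurable_fun_prod _ fun i _ => (hgm i).comp (hXm i)
    · exact ae_of_all _ fun ω => Finset.prod_le_one' fun i _ => hgle i _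
    · filter_upwards [hfin] with ω hω
      refine tendsto_prod_range_finprod (hsupp ω hω _ fun i hi hi' => ?_)
      simp only [hone i hi _ hi', lintegral_one, measure_univ]
  refine tendsto_nhds_unique h1 ?_
  simpa only [lintegral_prod_marked hXm hMm hXM hM hψ] using h2

end Marks

/-! ### The Laplace transform of the fading -/

section Exponential

/-- Tilting the rate-one density by `exp (-c h)` gives `(1 + c)⁻¹` times the density of rate `1 +
c`, whose total mass is one. -/
lemma lintegral_exp_neg_mul_expMeasure {c : ℝ} (hc : 0 ≤ c) :
    ∫⁻ h, ENNReal.ofReal (Real.exp (-(c * h))) ∂(expMeasure 1) = ENNReal.ofReal (1 + c)⁻¹ := by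
  have hm : Measurable (exponentialPDF 1) := (measurable_exponentialPDFReal 1).ennreal_ofReal
  have hm' : Measurable (exponentialPDF (1 + c)) :=
    (measurable_exponentialPDFReal (1 + c)).ennreal_ofReal
  change ∫⁻ h, ENNReal.ofReal (Real.exp (-(c * h))) ∂(volume.withDensity (exponentialPDF 1)) = _
  rw [lintegral_withDensity_eq_lintegral_mul _ hm (by fun_prop)]
  have h : ∀ y, (exponentialPDF 1 * fun y => ENNReal.ofReal (Real.exp (-(c * y)))) y =
      ENNReal.ofReal (1 + c)⁻¹ * exponentialPDF (1 + c) y := by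
    intro y
    rw [Pi.mul_apply]
    rcases lt_or_ge y 0 with hy | hy
    · rw [exponentialPDF_of_neg hy, exponentialPDF_of_neg hy, zero_mul, mul_zero]
    · rw [exponentialPDF_of_nonneg hy, exponentialPDF_of_nonneg hy,
        ← ENNReal.ofReal_mul (by positivity), ← ENNReal.ofReal_mul (by positivity),
        inv_mul_cancel_left₀ (by positivity), one_mul, ← Real.exp_add]
      congr 2
      ring
  rw [lintegral_congr h, lintegral_const_mul _ hm',
    lintegral_exponentialPDF_eq_one (by positivity), mul_one]

lemma ae_nonneg_expMeasure : ∀ᵐ h ∂(expMeasure 1), 0 ≤ h := by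
  rw [ae_iff]
  simp only [not_le]
  change volume.withDensity (exponentialPDF 1) (Set.Iio 0) = 0
  rw [withDensity_apply _ measurableSet_Iio, lintegral_exponentialPDF_of_nonpos le_rfl]

end Exponential

section FiniteProducts

lemma finprod_ite_eq_mul {M : Type*} [CommMonoid M] (k : ℕ) (w : M) {f : ℕ → M}
    (hf : (Function.mulSupport f).Finite) :
    ∏ᶠ i, (if i = k then w else f i) = w * ∏ᶠ i, (if i = k then 1 else f i) := by
  have h1 : (Function.mulSupport fun i => if i = k then w else 1).Finite :=
    (Set.finite_singleton k).subset fun i hi => by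
      by_contra hik
      exact hi (if_neg hik)
  have h2 : (Function.mulSupport fun i => if i = k then 1 else f i).Finite :=
    hf.subset fun i hi h => hi (by simp only [h, ite_self])
  have h3 : ∏ᶠ i, (if i = k then w else 1) = w := by
    rw [finprod_eq_single _ k fun i hi => if_neg hi, if_pos rfl]
  rw [← h3, ← finprod_mul_distrib h1 h2, h3]
  refine finprod_congr fun i => ?_
  by_cases h : i = k <;> simp [h]

end FiniteProducts

/-! ### The factor of one vehicle and its mean -/

namespace SLPParams

variable (P : SLPParams)

lemma lam_nonneg : 0 ≤ P.lam := mul_nonneg P.lamL_pos.le (Nat.cast_nonneg _)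

/-- The mean power received from a transmitter at `y` by a receiver at `x`. -/
noncomputable def meanPower (x y : ℝ) : ℝ := (P.tau * |y - x|) ^ (-P.alpha) * P.rho

lemma meanPower_nonneg (x y : ℝ) : 0 ≤ P.meanPower x y := by
  have := P.tau_pos
  have := P.rho_pos
  unfold meanPower
  positivity

lemma measurable_meanPower (x : ℝ) : Measurable (P.meanPower x) := by
  unfold meanPower
  fun_prop

/-- At `y = x` this fails: `0 ^ (-α)` is `0` by convention, so the left side is `0` whereas `outage
s 0 = 1`. A single point is negligible under the integral. -/
lemma one_sub_inv_one_add_meanPower {s x y : ℝ} (hs : 0 < s) (hy : y ≠ x) :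
    1 - (1 + s * P.meanPower x y)⁻¹ = P.outage s |y - x| := by
  have hτ := P.tau_pos
  have hρ := P.rho_pos
  have habs : 0 < |y - x| := abs_pos.2 (sub_ne_zero.2 hy)
  have h0 : 0 < P.tau * |y - x| := by positivity
  unfold meanPower outage
  rw [Real.rpow_neg h0.le]
  have hr : 0 < (P.tau * |y - x|) ^ P.alpha := Real.rpow_pos_of_pos h0 _
  field_simp
  ring

open Classical in
/-- The factor `exp (-s H (τ |y - x|)^(-α) ρ)` contributed to `exp (-s I(x))` by a vehicle with
position, activity and fading `(y, a, H)`. -/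
noncomputable def laplaceFactor (s x : ℝ) (p : ℝ × Bool × ℝ) : ENNReal :=
  if p.2.1 = true ∧ p.1 ∈ P.region x then
    ENNReal.ofReal (Real.exp (-(s * P.meanPower x p.1 * p.2.2))) else 1

lemma measurable_laplaceFactor (s x : ℝ) : Measurable (P.laplaceFactor s x) := by
  have hp := P.measurable_meanPower x
  refine Measurable.ite ?_ (by fun_prop) measurable_const
  refine MeasurableSet.inter (s₁ := {p : ℝ × Bool × ℝ | p.2.1 = true})
    (s₂ := {p : ℝ × Bool × ℝ | p.1 ∈ P.region x}) ?_ (measurable_fst (P.measurableSet_region x))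
  exact (measurable_fst.comp measurable_snd) (measurableSet_singleton true)

lemma laplaceFactor_of_notMem {s x y : ℝ} (hy : y ∉ P.region x) (m : Bool × ℝ) :
    P.laplaceFactor s x (y, m) = 1 := if_neg fun h => hy h.2

open Classical in
/-- The mean of `laplaceFactor` over the activity and the fading of a vehicle at `y`. -/
noncomputable def meanFactor (s x y : ℝ) : ENNReal :=
  if y ∈ P.region x then ENNReal.ofReal (1 - P.pa * (1 - (1 + s * P.meanPower x y)⁻¹)) else 1

lemma measurable_meanFactor (s x : ℝ) : Measurable (P.meanFactor s x) := by
  have hp := P.measurable_meanPower x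
  exact Measurable.ite (P.measurableSet_region x) (by fun_prop) measurable_const

lemma meanFactor_of_notMem {s x y : ℝ} (hy : y ∉ P.region x) : P.meanFactor s x y = 1 :=
  if_neg hy

lemma meanFactor_le_one {s : ℝ} (hs : 0 ≤ s) (x y : ℝ) : P.meanFactor s x y ≤ 1 := by
  unfold meanFactor
  split_ifs
  · have h1 : 0 ≤ s * P.meanPower x y := mul_nonneg hs (P.meanPower_nonneg x y)
    have h2 : (1 + s * P.meanPower x y)⁻¹ ≤ 1 := inv_le_one_of_one_le₀ (by linarith)
    rw [ENNReal.ofReal_le_one]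
    nlinarith [P.pa_pos]
  · exact le_rfl

lemma toReal_lintegral_meanFactor {s : ℝ} (hs : 0 < s) (x : ℝ) :
    (∫⁻ y in P.region x, P.meanFactor s x y).toReal - (volume (P.region x)).toReal =
      -(P.pa * ∫ y in P.region x, P.outage s |y - x|) := by
  have hint := P.integrableOn_outage hs x
  have hone : IntegrableOn (fun _ => (1 : ℝ)) (P.region x) :=
    integrableOn_const (P.volume_region_ne_top x)
  have hcongr : ∫⁻ y in P.region x, P.meanFactor s x y =
      ∫⁻ y in P.region x, ENNReal.ofReal (1 - P.pa * P.outage s |y - x|) := by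
    refine setLIntegral_congr_fun_ae (P.measurableSet_region x) ?_
    have hae : ∀ᵐ y : ℝ, y ≠ x := by simp [ae_iff]
    filter_upwards [hae] with y hy hyr
    rw [meanFactor, if_pos hyr, P.one_sub_inv_one_add_meanPower hs hy]
  have hnonneg : ∀ y, 0 ≤ 1 - P.pa * P.outage s |y - x| := fun y => by
    have h := P.outage_abs_mem_Icc hs (y - x)
    have := mul_le_one₀ P.pa_le_one h.1 h.2
    linarith
  have hdiff : IntegrableOn (fun y => 1 - P.pa * P.outage s |y - x|) (P.region x) :=
    hone.sub (hint.const_mul _)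
  rw [hcongr, ← ofReal_integral_eq_lintegral_ofReal hdiff
    (ae_of_all _ hnonneg), ENNReal.toReal_ofReal (integral_nonneg hnonneg),
    integral_sub hone (hint.const_mul _), integral_const_mul]
  simp [measureReal_def]

end SLPParams

/-! ### The interference as a product over vehicles -/

section Interference

variable {Ω : Type*} {P : SLPParams} {X : ℕ → Ω → ℝ} {A : ℕ → Ω → Bool} {H : ℕ → Ω → ℝ}

open Classical in
-- With finitely many points in the region the interference is a finite sum, and the exponential
-- makes it a product; inactive vehicles and those outside `J` give `1`.
lemma ofReal_exp_neg_interference {s x : ℝ} {ω : Ω} (hω : {i | X i ω ∈ P.region x}.Finite)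
    (J : Set ℕ) :
    ENNReal.ofReal (Real.exp (-(s * interference P X A H J x ω))) =
      ∏ᶠ i, (if i ∈ J then P.laplaceFactor s x (X i ω, A i ω, H i ω) else 1) := by
  have hnot : ∀ i ∉ hω.toFinset, X i ω ∉ P.region x := fun i hi => by simpa using hi
  rw [finprod_eq_prod_of_mulSupport_subset (s := hω.toFinset) _ fun i hi => by
      by_contra hi'
      exact hi (by simp only [P.laplaceFactor_of_notMem (hnot i hi'), ite_self]),
    interference, tsum_eq_sum (s := hω.toFinset) fun i hi =>
      Set.indicator_of_notMem (fun h => hnot i hi ⟨h.2.2.1, h.2.2.2⟩) _,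
    Finset.mul_sum, ← Finset.sum_neg_distrib, Real.exp_sum,
    ENNReal.ofReal_prod_of_nonneg fun _ _ => (Real.exp_pos _).le]
  refine Finset.prod_congr rfl fun i hi => ?_
  have hi' : X i ω ∈ P.region x := by simpa using hi
  have hmem : i ∈ interferers P X A J x ω ↔ i ∈ J ∧ A i ω = true :=
    ⟨fun h => ⟨h.1, h.2.1⟩, fun h => ⟨h.1, h.2, hi'.1, hi'.2⟩⟩
  by_cases hJ : i ∈ J <;> by_cases hA : A i ω = true <;>
    simp only [Set.indicator_apply, hmem, hJ, hA, hi', SLPParams.laplaceFactor, and_self, and_true, and_false, if_true, if_false, mul_zero, neg_zero, Real.exp_zero,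
      ENNReal.ofReal_one, Bool.false_eq_true]
  rw [SLPParams.meanPower]
  congr 3
  ring

lemma mulSupport_laplaceFactor_finite {s x : ℝ} {ω : Ω}
    (hω : {i | X i ω ∈ P.region x}.Finite) :
    (Function.mulSupport fun i => P.laplaceFactor s x (X i ω, A i ω, H i ω)).Finite :=
  hω.subset fun _ hi => by_contra fun hi' => hi (P.laplaceFactor_of_notMem hi' _)

end Interference

/-! ### The Laplace transforms of the network -/

namespace IsSLPNetwork

variable {Ω : Type*} [MeasurableSpace Ω] {μ : Measure Ω} {P : SLPParams}
  {X : ℕ → Ω → ℝ} {A : ℕ → Ω → Bool} {H : ℕ → Ω → ℝ}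

lemma ae_fading_nonneg (hnet : IsSLPNetwork μ P X A H) (i : ℕ) : ∀ᵐ ω ∂μ, 0 ≤ H i ω := by
  have h := ae_nonneg_expMeasure
  rw [← (hnet.fading_law i).map_eq] at h
  exact ae_of_ae_map (hnet.measurable_fading i).aemeasurable h

lemma measurable_mark (hnet : IsSLPNetwork μ P X A H) (i : ℕ) :
    Measurable fun ω => (A i ω, H i ω) :=
  (hnet.measurable_active i).prodMk (hnet.measurable_fading i)

lemma laplaceFactor_le_one (hnet : IsSLPNetwork μ P X A H) {s : ℝ} (hs : 0 ≤ s) (x : ℝ) (i : ℕ) :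
    ∀ᵐ ω ∂μ, ∀ y, P.laplaceFactor s x (y, A i ω, H i ω) ≤ 1 := by
  filter_upwards [hnet.ae_fading_nonneg i] with ω hω y
  unfold SLPParams.laplaceFactor
  split_ifs
  · rw [ENNReal.ofReal_le_one, Real.exp_le_one_iff]
    exact neg_nonpos.2 (mul_nonneg (mul_nonneg hs (P.meanPower_nonneg x y)) hω)
  · exact le_rfl

variable [IsProbabilityMeasure μ]

lemma ae_finite_region (hnet : IsSLPNetwork μ P X A H) (x : ℝ) :
    ∀ᵐ ω ∂μ, {i | X i ω ∈ P.region x}.Finite :=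
  hnet.poisson.ae_finite (P.measurableSet_region x) (P.volume_region_ne_top x)

lemma lintegral_active (hnet : IsSLPNetwork μ P X A H) (i : ℕ) (u v : ENNReal) :
    ∫⁻ ω, (if A i ω = true then u else v) ∂μ =
      ENNReal.ofReal P.pa * u + ENNReal.ofReal (1 - P.pa) * v := by
  have hA : MeasurableSet {ω | A i ω = true} :=
    hnet.measurable_active i (measurableSet_singleton true)
  have hc : μ {ω | A i ω = true}ᶜ = ENNReal.ofReal (1 - P.pa) := by
    rw [prob_compl_eq_one_sub hA, hnet.active_law i, ENNReal.ofReal_sub _ P.pa_pos.le,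
      ENNReal.ofReal_one]
  have hu : ∫⁻ ω in {ω | A i ω = true}, (if A i ω = true then u else v) ∂μ =
      ENNReal.ofReal P.pa * u := by
    rw [setLIntegral_congr_fun (g := fun _ => u) hA fun ω (hω : A i ω = true) => if_pos hω,
      setLIntegral_const, hnet.active_law i, mul_comm]
  have hv : ∫⁻ ω in {ω | A i ω = true}ᶜ, (if A i ω = true then u else v) ∂μ =
      ENNReal.ofReal (1 - P.pa) * v := by
    rw [setLIntegral_congr_fun (g := fun _ => v) hA.compl
      fun ω (hω : ¬ A i ω = true) => if_neg hω, setLIntegral_const, hc, mul_comm]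
  rw [← lintegral_add_compl _ hA, hu, hv]

lemma lintegral_laplaceFactor (hnet : IsSLPNetwork μ P X A H) {s : ℝ} (hs : 0 ≤ s) (x y : ℝ)
    (i : ℕ) : ∫⁻ ω, P.laplaceFactor s x (y, A i ω, H i ω) ∂μ = P.meanFactor s x y := by
  classical
  by_cases hy : y ∈ P.region x
  swap
  · simp only [P.laplaceFactor_of_notMem hy, P.meanFactor_of_notMem hy, lintegral_one, measure_univ]
  have hc : 0 ≤ s * P.meanPower x y := mul_nonneg hs (P.meanPower_nonneg x y)
  let e : ℝ → ENNReal := fun h => ENNReal.ofReal (Real.exp (-(s * P.meanPower x y * h)))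
  have he : Measurable e := by fun_prop
  have heH : ∫⁻ ω, e (H i ω) ∂μ = ENNReal.ofReal (1 + s * P.meanPower x y)⁻¹ := by
    rw [← lintegral_map he (hnet.measurable_fading i), (hnet.fading_law i).map_eq,
      lintegral_exp_neg_mul_expMeasure hc]
  have hind : IndepFun (fun ω => if A i ω = true then (1 : ENNReal) else 0) (fun ω => e (H i ω)) μ :=
    (hnet.indep_active_fading i).comp (φ := fun a : Bool => if a = true then (1 : ENNReal) else 0)
      .of_discrete he
  have hm : Measurable fun ω => if A i ω = true then (1 : ENNReal) else 0 :=
    (Measurable.of_discrete (f := fun a : Bool => if a = true then (1 : ENNReal) else 0)).comp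
      (hnet.measurable_active i)
  -- Separating the inactive case leaves a product of a function of the activity and a function of
  -- the fading, whose means multiply.
  have hsplit : ∀ ω, P.laplaceFactor s x (y, A i ω, H i ω) =
      (if A i ω = true then 1 else 0) * e (H i ω) + (if A i ω = true then 0 else 1) := by
    intro ω
    by_cases hA : A i ω = true <;> simp [SLPParams.laplaceFactor, hA, hy, e]
  have hprod : Measurable fun ω => (if A i ω = true then (1 : ENNReal) else 0) * e (H i ω) :=
    hm.mul (he.comp (hnet.measurable_fading i))
  have hmul : ∫⁻ ω, (if A i ω = true then (1 : ENNReal) else 0) * e (H i ω) ∂μ =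
      (∫⁻ ω, (if A i ω = true then (1 : ENNReal) else 0) ∂μ) * ∫⁻ ω, e (H i ω) ∂μ :=
    lintegral_mul_eq_lintegral_mul_lintegral_of_indepFun hm
      (he.comp (hnet.measurable_fading i)) hind
  have hinv : 0 ≤ (1 + s * P.meanPower x y)⁻¹ := by positivity
  rw [lintegral_congr hsplit, lintegral_add_left hprod, hmul, heH, hnet.lintegral_active i 1 0, hnet.lintegral_active i 0 1, mul_one, mul_zero,
    mul_zero, mul_one, add_zero, zero_add, ← ENNReal.ofReal_mul P.pa_pos.le,
    ← ENNReal.ofReal_add (mul_nonneg P.pa_pos.le hinv) (sub_nonneg.2 P.pa_le_one),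
    SLPParams.meanFactor, if_pos hy]
  congr 1
  ring

lemma lintegral_exp_neg_interference_eq (hnet : IsSLPNetwork μ P X A H) {s : ℝ} (hs : 0 ≤ s)
    (x : ℝ) :
    ∫⁻ ω, ENNReal.ofReal (Real.exp (-(s * interference P X A H Set.univ x ω))) ∂μ =
      ∫⁻ ω, ∏ᶠ i, P.meanFactor s x (X i ω) ∂μ := by
  have hcongr : ∀ᵐ ω ∂μ,
      ENNReal.ofReal (Real.exp (-(s * interference P X A H Set.univ x ω))) =
        ∏ᶠ i, P.laplaceFactor s x (X i ω, A i ω, H i ω) := by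
    filter_upwards [hnet.ae_finite_region x] with ω hω
    simp only [ofReal_exp_neg_interference hω, Set.mem_univ, if_true]
  rw [lintegral_congr_ae hcongr, lintegral_finprod_marked (M := fun i ω => (A i ω, H i ω))
    hnet.poisson.measurable hnet.measurable_mark
    hnet.indep_positions hnet.indep_marks (ψ := fun _ => P.laplaceFactor s x)
    (fun _ => P.measurable_laplaceFactor s x) (fun i => hnet.laplaceFactor_le_one hs x i)
    Set.finite_empty (hnet.ae_finite_region x) fun _ _ y hy m => P.laplaceFactor_of_notMem hy m]
  simp only [hnet.lintegral_laplaceFactor hs]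

theorem lintegral_exp_neg_interference (hnet : IsSLPNetwork μ P X A H) {s : ℝ} (hs : 0 < s)
    (x : ℝ) :
    ∫⁻ ω, ENNReal.ofReal (Real.exp (-(s * interference P X A H Set.univ x ω))) ∂μ =
      ENNReal.ofReal (Real.exp (-(P.lam * P.pa * ∑ᶠ c : ℤ, P.kappa c s x))) := by
  rw [hnet.lintegral_exp_neg_interference_eq hs.le, hnet.poisson.lintegral_finprod (P.lam_nonneg)
    (P.measurableSet_region x) (P.volume_region_ne_top x) (P.measurable_meanFactor s x)
    ENNReal.one_ne_top (P.meanFactor_le_one hs.le x) (fun y hy => P.meanFactor_of_notMem hy),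
    P.toReal_lintegral_meanFactor hs, P.integral_region_eq_finsum_kappa hs]
  congr 2
  ring

lemma aemeasurable_exp_neg_interference (hnet : IsSLPNetwork μ P X A H) (s x : ℝ) (J : Set ℕ) :
    AEMeasurable (fun ω => ENNReal.ofReal (Real.exp (-(s * interference P X A H J x ω)))) μ := by
  classical
  have h : AEMeasurable (fun ω => ∏ᶠ i,
      (if i ∈ J then P.laplaceFactor s x (X i ω, A i ω, H i ω) else 1)) μ := by
    refine aemeasurable_finprod_of_finite (fun i => ?_) ?_
    · by_cases hi : i ∈ J
      · simpa only [hi, if_true] using! ((P.measurable_laplaceFactor s x).comp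
          ((hnet.poisson.measurable i).prodMk (hnet.measurable_mark i))).aemeasurable
      · simp only [hi, if_false, aemeasurable_const]
    · filter_upwards [hnet.ae_finite_region x] with ω hω
      refine (mulSupport_laplaceFactor_finite (s := s) (A := A) (H := H) hω).subset
        fun i hi h => hi ?_
      simp only [h, ite_self]
  refine h.congr ?_
  filter_upwards [hnet.ae_finite_region x] with ω hω
  exact (ofReal_exp_neg_interference hω J).symm

lemma fullLaplace_eq (hnet : IsSLPNetwork μ P X A H) {s : ℝ} (hs : 0 < s) (x : ℝ) :
    fullLaplace μ P X A H s x = Real.exp (-(P.lam * P.pa * ∑ᶠ c : ℤ, P.kappa c s x)) := by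
  have h := integral_toReal (hnet.aemeasurable_exp_neg_interference s x Set.univ)
    (ae_of_all _ fun _ => ENNReal.ofReal_lt_top)
  rw [hnet.lintegral_exp_neg_interference hs, ENNReal.toReal_ofReal (Real.exp_pos _).le] at h
  rw [← h, fullLaplace]
  exact integral_congr_ae (ae_of_all _ fun ω => (ENNReal.toReal_ofReal (Real.exp_pos _).le).symm)

/-- The Mecke formula for the network: the sum, over the active vehicles in `B`, of the Laplace
variable of the interference caused by the others. -/
theorem lintegral_tsum_activeIn (hnet : IsSLPNetwork μ P X A H) {s : ℝ} (hs : 0 ≤ s) (x : ℝ)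
    {B : Set ℝ} (hB : MeasurableSet B) (hB' : volume B ≠ ⊤) :
    ∫⁻ ω, ∑' k, (activeIn X A B ω).indicator
      (fun k => ENNReal.ofReal (Real.exp (-(s * interference P X A H {k}ᶜ x ω)))) k ∂μ =
      ENNReal.ofReal P.pa * (ENNReal.ofReal (P.lam * (volume B).toReal) *
        ∫⁻ ω, ENNReal.ofReal (Real.exp (-(s * interference P X A H Set.univ x ω))) ∂μ) := by
  classical
  let b : ℝ → ENNReal := B.indicator 1
  have hbm : Measurable b := measurable_one.indicator hB
  have hb_le : ∀ y, b y ≤ 1 := fun y => Set.indicator_le_self' (fun _ _ => zero_le) y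
  have hact : ∀ k, MeasurableSet {ω | k ∈ activeIn X A B ω} := fun k =>
    (hnet.measurable_active k (measurableSet_singleton true)).inter (hnet.poisson.measurable k hB)
  have hmeas : ∀ k, AEMeasurable (fun ω => (activeIn X A B ω).indicator
      (fun k => ENNReal.ofReal (Real.exp (-(s * interference P X A H {k}ᶜ x ω)))) k) μ := by
    intro k
    exact (hnet.aemeasurable_exp_neg_interference s x {k}ᶜ).indicator (hact k)
  -- The `k`-th factor becomes the indicator that vehicle `k` is active and in `B`. Each summand is
  -- then again a product over all vehicles, and averaging the marks turns that factor into `p_a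
  -- 1_B`.
  let ψ : ℕ → ℕ → ℝ × Bool × ℝ → ENNReal := fun k i p =>
    if i = k then (if p.2.1 = true then b p.1 else 0) else P.laplaceFactor s x p
  have hψm : ∀ k i, Measurable (ψ k i) := by
    intro k i
    by_cases hik : i = k
    · simp only [ψ, hik, if_true]
      exact Measurable.ite ((measurable_fst.comp measurable_snd) (measurableSet_singleton true))
        (hbm.comp measurable_fst) measurable_const
    · simp only [ψ, hik, if_false]
      exact P.measurable_laplaceFactor s x
  have hψ_le : ∀ k i, ∀ᵐ ω ∂μ, ∀ y, ψ k i (y, A i ω, H i ω) ≤ 1 := by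
    intro k i
    filter_upwards [hnet.laplaceFactor_le_one hs x i] with ω hω y
    simp only [ψ]
    split_ifs
    exacts [hb_le y, zero_le, hω y]
  have hψ_one : ∀ k, ∀ i ∉ ({k} : Set ℕ), ∀ y ∉ P.region x, ∀ m, ψ k i (y, m) = 1 := by
    intro k i hi y hy m
    simp only [ψ]
    rw [if_neg (by simpa using hi), P.laplaceFactor_of_notMem hy]
  have hterm : ∀ k, ∫⁻ ω, (activeIn X A B ω).indicator
      (fun k => ENNReal.ofReal (Real.exp (-(s * interference P X A H {k}ᶜ x ω)))) k ∂μ =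
      ENNReal.ofReal P.pa *
        ∫⁻ ω, ∏ᶠ i, (if i = k then b (X i ω) else P.meanFactor s x (X i ω)) ∂μ := by
    intro k
    have hcongr : ∀ᵐ ω ∂μ, (activeIn X A B ω).indicator
        (fun k => ENNReal.ofReal (Real.exp (-(s * interference P X A H {k}ᶜ x ω)))) k =
        ∏ᶠ i, ψ k i (X i ω, A i ω, H i ω) := by
      filter_upwards [hnet.ae_finite_region x] with ω hω
      have hψ_eq : ∀ i, ψ k i (X i ω, A i ω, H i ω) =
          if i = k then (if A k ω = true then b (X k ω) else 0) else
            P.laplaceFactor s x (X i ω, A i ω, H i ω) := by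
        intro i
        by_cases hik : i = k
        · subst hik
          simp only [ψ, if_true]
        · simp only [ψ, hik, if_false]
      rw [finprod_congr hψ_eq, finprod_ite_eq_mul k _ (mulSupport_laplaceFactor_finite hω)]
      have hint := ofReal_exp_neg_interference (s := s) (A := A) (H := H) hω {k}ᶜ
      simp only [Set.mem_compl_iff, Set.mem_singleton_iff, ite_not] at hint
      rw [Set.indicator_apply, hint]
      by_cases hA : A k ω = true <;> by_cases hk : X k ω ∈ B <;>
        simp [activeIn, b, hA, hk]
    rw [lintegral_congr_ae hcongr, lintegral_finprod_marked (M := fun i ω => (A i ω, H i ω))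
      hnet.poisson.measurable hnet.measurable_mark hnet.indep_positions hnet.indep_marks (hψm k)
      (hψ_le k) (Set.finite_singleton k) (hnet.ae_finite_region x) (hψ_one k),
      ← lintegral_const_mul' _ _ ENNReal.ofReal_ne_top]
    refine lintegral_congr_ae ?_
    filter_upwards [hnet.ae_finite_region x] with ω hω
    have hmean : ∀ i, ∫⁻ ω', ψ k i (X i ω, A i ω', H i ω') ∂μ =
        if i = k then ENNReal.ofReal P.pa * b (X k ω) else P.meanFactor s x (X i ω) := by
      intro i
      by_cases hik : i = k
      · subst hik
        simp only [ψ, if_true, hnet.lintegral_active, mul_zero, add_zero]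
      · simp only [ψ, hik, if_false, hnet.lintegral_laplaceFactor hs]
    have hsupp : (Function.mulSupport fun i => P.meanFactor s x (X i ω)).Finite :=
      hω.subset fun _ hi => by_contra fun hi' => hi (P.meanFactor_of_notMem hi')
    have hk : ∀ i, (if i = k then b (X i ω) else P.meanFactor s x (X i ω)) =
        if i = k then b (X k ω) else P.meanFactor s x (X i ω) := by
      intro i
      by_cases hik : i = k
      · rw [hik]
      · simp only [hik, if_false]
    simp only [hmean, hk]
    rw [finprod_ite_eq_mul k (ENNReal.ofReal P.pa * b (X k ω)) hsupp,
      finprod_ite_eq_mul k (b (X k ω)) hsupp, mul_assoc]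
  rw [lintegral_tsum hmeas, tsum_congr hterm, ENNReal.tsum_mul_left,
    hnet.lintegral_exp_neg_interference_eq hs]
  congr 1
  -- The window is enlarged by `B`, since the transmitter may be out of range of `x`.
  refine hnet.poisson.tsum_lintegral_finprod (P.lam_nonneg) (W := P.region x ∪ B)
    ((P.measurableSet_region x).union hB) ?_ hB Set.subset_union_right
    (P.measurable_meanFactor s x) (P.meanFactor_le_one hs x) fun y hy =>
      P.meanFactor_of_notMem fun h => hy (Or.inl h)
  exact (measure_union_lt_top (P.volume_region_ne_top x).lt_top hB'.lt_top).ne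

lemma typicalLaplace_eq (hnet : IsSLPNetwork μ P X A H) {s : ℝ} (hs : 0 < s) (x : ℝ)
    {B : Set ℝ} (hB : MeasurableSet B) (hBseg : B ⊆ P.segment 0) (hB0 : volume B ≠ 0) :
    typicalLaplace μ P X A H B s x =
      ENNReal.ofReal (Real.exp (-(P.lam * P.pa * ∑ᶠ c : ℤ, P.kappa c s x))) := by
  have hBtop : volume B ≠ ⊤ := by
    refine measure_ne_top_of_subset hBseg ?_
    change volume (Set.Ico _ _) ≠ ⊤
    exact measure_Ico_lt_top.ne
  -- At `s = 0` every exponential is `1`, so the numerator formula computes the denominator.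
  have hden := hnet.lintegral_tsum_activeIn le_rfl x hB hBtop
  simp only [zero_mul, neg_zero, Real.exp_zero, ENNReal.ofReal_one, lintegral_one, measure_univ,
    mul_one] at hden
  have hlam : 0 < P.lam := mul_pos P.lamL_pos (Nat.cast_pos.2 P.nL_pos)
  have hpos : ENNReal.ofReal P.pa * ENNReal.ofReal (P.lam * (volume B).toReal) ≠ 0 :=
    mul_ne_zero (ENNReal.ofReal_pos.2 P.pa_pos).ne'
      (ENNReal.ofReal_pos.2 (mul_pos hlam (ENNReal.toReal_pos hB0 hBtop))).ne'
  rw [typicalLaplace, hden, hnet.lintegral_tsum_activeIn hs.le x hB hBtop,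
    hnet.lintegral_exp_neg_interference hs, ← mul_assoc, mul_comm,
    ENNReal.mul_div_cancel_right hpos (ENNReal.mul_ne_top ENNReal.ofReal_ne_top
      ENNReal.ofReal_ne_top)]

theorem isInterferenceLaplace (hnet : IsSLPNetwork μ P X A H) {s : ℝ} (hs : 0 < s) (x : ℝ) :
    IsInterferenceLaplace μ P X A H s x
      (Real.exp (-(P.lam * P.pa * ∑ᶠ c : ℤ, P.kappa c s x))) :=
  ⟨hnet.fullLaplace_eq hs x, fun _ hB hBseg hB0 => hnet.typicalLaplace_eq hs x hB hBseg hB0⟩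

end IsSLPNetwork

theorem lemma1 {Ω : Type*} [MeasurableSpace Ω] (μ : Measure Ω) [IsProbabilityMeasure μ]
    (P : SLPParams) (X : ℕ → Ω → ℝ) (A : ℕ → Ω → Bool) (H : ℕ → Ω → ℝ)
    (hnet : IsSLPNetwork μ P X A H) (x s : ℝ) (hs : 0 < s) :
    -- only the clusters whose co-channel segment meets the range of the receiver contribute
    (∀ c : ℤ, P.kappa c s x ≠ 0 → |c * P.dC - x| < P.dmax + P.dA / 2) ∧
    -- for every receiver location, with the sum over all clusters
    IsInterferenceLaplace μ P X A H s x
      (Real.exp (-(P.lam * P.pa * ∑ᶠ c : ℤ, P.kappa c s x))) ∧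
    -- the sum over `|c| ≤ ⌈dmax / (nAR dA)⌉`
    (|x| + P.dmax ≤ (⌈P.dmax / P.dC⌉ + 1) * P.dC - P.dA / 2 →
      IsInterferenceLaplace μ P X A H s x
        (Real.exp (-(P.lam * P.pa *
          ∑ c ∈ Finset.Icc (-⌈P.dmax / P.dC⌉) ⌈P.dmax / P.dC⌉, P.kappa c s x)))) ∧
    -- the sum over `-⌊dmax / (nAR dA)⌋ ≤ c ≤ ⌈dmax / (nAR dA)⌉`
    (P.dmax + x ≤ (⌈P.dmax / P.dC⌉ + 1) * P.dC - P.dA / 2 →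
      P.dmax - x ≤ (⌊P.dmax / P.dC⌋ + 1) * P.dC - P.dA / 2 →
      IsInterferenceLaplace μ P X A H s x
        (Real.exp (-(P.lam * P.pa *
          ∑ c ∈ Finset.Icc (-⌊P.dmax / P.dC⌋) ⌈P.dmax / P.dC⌉, P.kappa c s x)))) := by
  have hlaplace := hnet.isInterferenceLaplace hs x
  refine ⟨fun c hc => not_le.1 (mt P.kappa_eq_zero hc), hlaplace, fun h => ?_, fun h1 h2 => ?_⟩
  -- Since `|x|` dominates both `x` and `-x`, the bound covers both ends of the symmetric range.
  · rwa [← P.finsum_kappa_eq_sum (by linarith [neg_abs_le x]) (by linarith [le_abs_self x])]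
  · rwa [← P.finsum_kappa_eq_sum h2 h1]
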